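/- All groups are finite and all characters are complex. For a finite group $G$, a character $\chi$ of $G$ is called QSI (quasi solvably induced) if there exist a subgroup $U\le G$, an irreducible character $\varphi\in\mathrm{Irr}(U)$ and a positive integer $k$ such that $k\chi=\varphi^G$ (the induced character) and $U/\ker(\varphi)$ is solvable. The group $G$ is called QSI if every $\chi\in\mathrm{Irr}(G)$ is QSI. Let $S=A_n$ with $n\ge 5$ and $n\ne 6$. Then: (1) For every integer $m\ge 1$ and every group $G$ with $S^m\le G\le \mathrm{Aut}(S^m)$, where $S^m$ is identified with its group of inner automorphisms, $G$ is not QSI. (2) The character $\chi_n=\pi_n-1$ of $A_n$, where $\pi_n(\sigma)$ is the number of fixed points of $\sigma$ on $\{1,\dots,n\}$, is irreducible and $\mathrm{Aut}(A_n)$-invariant, and it is not QSI. -/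

import Mathlib

namespace QSI

/-- `χ` is a complex character of `G`: the trace function of some finite-dimensional complex
representation of `G`. -/
def IsCharacter {G : Type*} [Group G] (χ : G → ℂ) : Prop :=
  ∃ (V : Type) (_ : AddCommGroup V) (_ : Module ℂ V) (_ : FiniteDimensional ℂ V)
    (ρ : Representation ℂ G V), ρ.character = χ

/-- `χ ∈ Irr(G)`: `χ` is the character of some irreducible finite-dimensional complex
representation of `G`. -/
def IsIrreducibleCharacter {G : Type*} [Group G] (χ : G → ℂ) : Prop :=
  ∃ (V : Type) (_ : AddCommGroup V) (_ : Module ℂ V) (_ : FiniteDimensional ℂ V)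
    (ρ : Representation ℂ G V), ρ.IsIrreducible ∧ ρ.character = χ

open scoped Classical in
/-- The induced class function `φ^G(x) = |U|⁻¹ ∑_{y ∈ G, y⁻¹xy ∈ U} φ(y⁻¹xy)`. -/
noncomputable def inducedCharacter {G : Type*} [Group G] [Finite G] (U : Subgroup G)
    (φ : U → ℂ) (x : G) : ℂ :=
  letI : Fintype G := Fintype.ofFinite G
  (Nat.card U : ℂ)⁻¹ * ∑ y : G, if h : y⁻¹ * x * y ∈ U then φ ⟨y⁻¹ * x * y, h⟩ else 0

/-- `χ` is QSI (quasi solvably induced) from `U ≤ G` and `φ ∈ Irr(U)`: `k χ = φ^G` for some positive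
integer `k`, and `U / ker φ` is solvable. The kernel of a character is the kernel of a
representation `ρ` affording it. -/
def IsQSIFrom {G : Type*} [Group G] [Finite G] (χ : G → ℂ) (U : Subgroup G) (φ : U → ℂ) : Prop :=
  (∃ (V : Type) (_ : AddCommGroup V) (_ : Module ℂ V) (_ : FiniteDimensional ℂ V)
    (ρ : Representation ℂ U V), ρ.IsIrreducible ∧ ρ.character = φ ∧
      Group.IsSolvable (U ⧸ MonoidHom.ker ρ)) ∧
  ∃ k : ℕ, 0 < k ∧ ∀ x : G, (k : ℂ) * χ x = inducedCharacter U φ x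

/-- The character `χ` of the finite group `G` is QSI. -/
def IsQSICharacter {G : Type*} [Group G] [Finite G] (χ : G → ℂ) : Prop :=
  IsCharacter χ ∧ ∃ (U : Subgroup G) (φ : U → ℂ), IsQSIFrom χ U φ

/-- The finite group `G` is QSI: all its irreducible complex characters are QSI. -/
def IsQSIGroup (G : Type*) [Group G] [Finite G] : Prop :=
  ∀ χ : G → ℂ, IsIrreducibleCharacter χ → IsQSICharacter χ

/-- `χ_n = π_n - 1` on `A_n`, where `π_n(σ)` is the number of fixed points of `σ`, the permutation
character of the natural action of `A_n` on `n` points. -/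
noncomputable def altChar (n : ℕ) (σ : alternatingGroup (Fin n)) : ℂ :=
  (Nat.card {i : Fin n // (σ : Equiv.Perm (Fin n)) i = i} : ℂ) - 1

end QSI

/-!
Let `χ_n` be the character `altChar n` of `A_n`, and let `f` embed `A_n ^ m` into a finite group `G`
that normalizes its image. If a function `χ` on `G` restricts on `A_n ^ m` to a nonzero multiple of
the product `θ = χ_n × ⋯ × χ_n`, then `χ` is not quasi solvably induced
(`not_isQSIFrom_of_restrict_eq`). Indeed, let `k χ = φ^G` with `φ` a character of `U`, where
`U / ker φ` is solvable. Wherever `χ` does not vanish, some conjugate of the argument lies in `U`.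

* For the diagonal elements `(s, …, s)` this shows that each projection of `U ∩ A_n ^ m` to a factor
  contains a counterpart of every `s` with `χ_n s ≠ 0`. Such a subgroup of `A_n` is transitive and
  primitive, because it contains counterparts of certain long cycles, and it contains a three-cycle,
  so that it is `A_n` by Jordan's theorem (`IsAbundant.alternatingGroup_le`).
* For a three-cycle in a single factor it shows that `U` meets some factor nontrivially. By the
  first point this intersection is normal in the factor, so `U` contains the factor.

As `A_n` is simple and not solvable, this factor lies in `ker φ`, and so `φ^G` restricted to it
contains the trivial character (`sum_inducedCharacter_ne_zero`); but `χ` restricts to a multiple of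
`χ_n`, which does not (`sum_altChar`).

It remains to find an irreducible `χ` with such a restriction when `G` lies between `A_n ^ m` and
its automorphism group. The product `θ` is invariant under automorphisms: these permute the factors
(`exists_perm_mulAut_pi`), and automorphisms of `A_n` preserve the number of fixed points
(`card_support_mulAut`). The latter holds because, for `n ≠ 6`, they preserve the class of
three-cycles and the number of common points of two three-cycles, and these data determine the
number of fixed points. Hence `∑ θ(y⁻¹) y` is central in the group algebra of `G`. Any irreducible
representation on which it acts by a nonzero scalar has a character `χ` with `χ` restricted to
`A_n ^ m` proportional to `θ` (`exists_irreducible_restrict_eq`). This uses only that convolving a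
class function with `θ` gives a multiple of `θ`, which follows, one factor at a time, from
Frobenius' functional equation for irreducible characters.
-/

namespace QSI

open Equiv Equiv.Perm

/-! ### Pairs of three-cycles -/

section ThreeCycles

variable {α : Type*} [Fintype α] [DecidableEq α]

lemma threeCycle_apply_apply_apply {s : Perm α} (hs : s.IsThreeCycle) (x : α) :
    s (s (s x)) = x := by
  have h : s ^ 3 = 1 := by rw [← hs.orderOf]; exact pow_orderOf_eq_one s
  simpa [pow_succ] using congrArg (fun g : Perm α => g x) h

lemma threeCycle_support {s : Perm α} (hs : s.IsThreeCycle) {x : α} (hx : s x ≠ x) :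
    s.support = {x, s x, s (s x)} ∧ s (s x) ≠ x ∧ s (s x) ≠ s x := by
  have h3 := threeCycle_apply_apply_apply hs x
  have h1 : s (s x) ≠ x := fun h => hx (by rw [h] at h3; exact h3)
  have h2 : s (s x) ≠ s x := fun h => hx (s.injective h)
  refine ⟨?_, h1, h2⟩
  symm
  apply Finset.eq_of_subset_of_card_le
  · intro y hy
    simp only [Finset.mem_insert, Finset.mem_singleton] at hy
    rcases hy with rfl | rfl | rfl <;> simp [hx]
  · rw [hs.card_support, Finset.card_eq_three.mpr ⟨x, s x, s (s x), hx.symm, h1.symm, h2.symm, rfl⟩]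

/-- Two three-cycles with the same support generate the same cyclic group. -/
lemma threeCycle_inter_eq_three_iff {s t : Perm α} (hs : s.IsThreeCycle) (ht : t.IsThreeCycle) :
    (s.support ∩ t.support).card = 3 ↔ t = s ∨ t = s⁻¹ := by
  constructor
  · intro h
    have hss : s.support ∩ t.support = s.support :=
      Finset.eq_of_subset_of_card_le Finset.inter_subset_left (by rw [h, hs.card_support])
    have hst : s.support ∩ t.support = t.support :=
      Finset.eq_of_subset_of_card_le Finset.inter_subset_right (by rw [h, ht.card_support])
    have heq : s.support = t.support := hss.symm.trans hst
    obtain ⟨x, hx⟩ : s.support.Nonempty := by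
      rw [← Finset.card_pos, hs.card_support]; norm_num
    have hxs : s x ≠ x := by simpa using hx
    have hxt : t x ≠ x := by rw [heq] at hx; simpa using hx
    obtain ⟨e1, a1, a2⟩ := threeCycle_support hs hxs
    obtain ⟨e2, b1, b2⟩ := threeCycle_support ht hxt
    have s3 := threeCycle_apply_apply_apply hs x
    have t3 := threeCycle_apply_apply_apply ht x
    have m1 : t x ∈ s.support := by rw [heq, e2]; simp
    have m2 : t (t x) ∈ s.support := by rw [heq, e2]; simp
    rw [e1] at m1 m2
    simp only [Finset.mem_insert, Finset.mem_singleton] at m1 m2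
    rcases m1 with m1 | m1 | m1
    · exact absurd m1 hxt
    · left
      have m2' : t (t x) = s (s x) := by
        rcases m2 with m2 | m2 | m2
        · exact absurd m2 b1
        · exact absurd (m2.trans m1.symm) b2
        · exact m2
      ext y
      by_cases hy : y ∈ s.support
      · rw [e1] at hy
        simp only [Finset.mem_insert, Finset.mem_singleton] at hy
        rcases hy with rfl | rfl | rfl
        · exact m1
        · rw [← m1, m2', m1]
        · rw [← m2', t3, m2', s3]
      · rw [notMem_support.mp hy]; rw [heq] at hy; exact notMem_support.mp hy
    · right
      have m2' : t (t x) = s x := by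
        rcases m2 with m2 | m2 | m2
        · exact absurd m2 b1
        · exact m2
        · exact absurd (m2.trans m1.symm) b2
      ext y
      rw [Perm.eq_inv_iff_eq]
      by_cases hy : y ∈ s.support
      · rw [e1] at hy
        simp only [Finset.mem_insert, Finset.mem_singleton] at hy
        rcases hy with rfl | rfl | rfl
        · rw [m1, s3]
        · rw [← m2', t3, m2']
        · rw [← m1, m2', m1]
      · rw [heq, notMem_support] at hy
        rw [hy]; rw [← notMem_support, ← heq, notMem_support] at hy; exact hy
  · rintro (rfl | rfl) <;> simp [hs.card_support]

/-- If two three-cycles share exactly one point, their product is a five-cycle. -/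
lemma threeCycle_mul_pow_five {s t : Perm α} (hs : s.IsThreeCycle) (ht : t.IsThreeCycle)
    (h : (s.support ∩ t.support).card = 1) : (s * t) ^ 5 = 1 := by
  obtain ⟨x, hx⟩ := Finset.card_eq_one.mp h
  have hxm : x ∈ s.support ∩ t.support := by rw [hx]; simp
  have hu : ∀ y, s y ≠ y → t y ≠ y → y = x := by
    intro y h1 h2
    have : y ∈ s.support ∩ t.support := by simp [h1, h2]
    rw [hx] at this; simpa using this
  simp only [Finset.mem_inter, mem_support] at hxm
  obtain ⟨hxs, hxt⟩ := hxm
  obtain ⟨e1, a1, a2⟩ := threeCycle_support hs hxs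
  obtain ⟨e2, b1, b2⟩ := threeCycle_support ht hxt
  have s3 := threeCycle_apply_apply_apply hs x
  have t3 := threeCycle_apply_apply_apply ht x
  -- The product is the cycle `x ↦ t x ↦ t (t x) ↦ s x ↦ s (s x) ↦ x`.
  have p1 : s (t x) = t x := by by_contra hc; exact hxt (hu _ hc b2)
  have p2 : s (t (t x)) = t (t x) := by
    by_contra hc; exact b1 (hu _ hc (by rw [t3]; exact b1.symm))
  have q1 : t (s x) = s x := by by_contra hc; exact hxs (hu _ a2 hc)
  have q2 : t (s (s x)) = s (s x) := by
    by_contra hc; exact a1 (hu _ (by rw [s3]; exact a1.symm) hc)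
  ext y
  by_cases hy : s y = y
  · by_cases hy' : t y = y
    · simp [pow_succ, hy, hy']
    · have : y ∈ t.support := by simpa using hy'
      rw [e2] at this
      simp only [Finset.mem_insert, Finset.mem_singleton] at this
      rcases this with rfl | rfl | rfl <;> simp [pow_succ, s3, t3, p1, p2, q1, q2]
  · have : y ∈ s.support := by simpa using hy
    rw [e1] at this
    simp only [Finset.mem_insert, Finset.mem_singleton] at this
    rcases this with rfl | rfl | rfl <;> simp [pow_succ, s3, t3, p1, p2, q1, q2]

/-- If two three-cycles share exactly two points and both send one of these to the other, their
product is a double transposition. -/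
lemma threeCycle_mul_sq_of_apply_eq {s t : Perm α} (hs : s.IsThreeCycle) (ht : t.IsThreeCycle)
    (h : (s.support ∩ t.support).card = 2) {x : α} (hx : s x ≠ x) (hst : s x = t x) :
    (s * t) ^ 2 = 1 := by
  have hxt : t x ≠ x := hst ▸ hx
  obtain ⟨e1, a1, a2⟩ := threeCycle_support hs hx
  obtain ⟨e2, b1, b2⟩ := threeCycle_support ht hxt
  have s3 := threeCycle_apply_apply_apply hs x
  have t3 := threeCycle_apply_apply_apply ht x
  have hsub : ({x, s x} : Finset α) = s.support ∩ t.support := by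
    apply Finset.eq_of_subset_of_card_le
    · intro y hy
      simp only [Finset.mem_insert, Finset.mem_singleton] at hy
      rcases hy with rfl | rfl
      · simp [hx, hxt]
      · simp [hx]; rw [hst]; simpa using hxt
    · rw [h, Finset.card_pair hx.symm]
  have hu : ∀ y, s y ≠ y → t y ≠ y → y = x ∨ y = s x := by
    intro y h1 h2
    have : y ∈ s.support ∩ t.support := by simp [h1, h2]
    rw [← hsub] at this; simpa using this
  have p : s (t (t x)) = t (t x) := by
    by_contra hc
    rcases hu _ hc (by rw [t3]; exact b1.symm) with h | h
    · exact b1 h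
    · exact b2 (h.trans hst)
  have q : t (s (s x)) = s (s x) := by
    by_contra hc
    rcases hu _ (by rw [s3]; exact a1.symm) hc with h | h
    · exact a1 h
    · exact a2 h
  have r : t (s x) = t (t x) := by rw [hst]
  ext y
  by_cases hy : s y = y
  · by_cases hy' : t y = y
    · simp [pow_succ, hy, hy']
    · have : y ∈ t.support := by simpa using hy'
      rw [e2] at this
      simp only [Finset.mem_insert, Finset.mem_singleton] at this
      rcases this with rfl | rfl | rfl <;> simp [pow_succ, s3, t3, p, q, r, ← hst]
  · have : y ∈ s.support := by simpa using hy
    rw [e1] at this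
    simp only [Finset.mem_insert, Finset.mem_singleton] at this
    rcases this with rfl | rfl | rfl <;> simp [pow_succ, s3, t3, p, q, r, ← hst]

lemma threeCycle_apply_eq_or {s : Perm α} (hs : s.IsThreeCycle) {x y : α}
    (hx : s x ≠ x) (hy : s y ≠ y) (hxy : x ≠ y) : s x = y ∨ s y = x := by
  obtain ⟨e1, a1, a2⟩ := threeCycle_support hs hx
  have : y ∈ s.support := by simpa using hy
  rw [e1] at this
  simp only [Finset.mem_insert, Finset.mem_singleton] at this
  rcases this with rfl | rfl | rfl
  · exact absurd rfl hxy
  · exact Or.inl rfl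
  · exact Or.inr (threeCycle_apply_apply_apply hs x)

lemma threeCycle_mul_sq_of_inter_eq_two {s t : Perm α} (hs : s.IsThreeCycle)
    (ht : t.IsThreeCycle) (h : (s.support ∩ t.support).card = 2) :
    (s * t) ^ 2 = 1 ∨ (s * t⁻¹) ^ 2 = 1 := by
  obtain ⟨x, y, hxy, he⟩ := Finset.card_eq_two.mp h
  have hx : x ∈ s.support ∩ t.support := by rw [he]; simp
  have hy : y ∈ s.support ∩ t.support := by rw [he]; simp
  simp only [Finset.mem_inter, mem_support] at hx hy
  have ht' : t⁻¹.IsThreeCycle := ht.inv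
  have h' : (s.support ∩ t⁻¹.support).card = 2 := by rwa [support_inv]
  rcases threeCycle_apply_eq_or hs hx.1 hy.1 hxy with h1 | h1 <;>
  rcases threeCycle_apply_eq_or ht hx.2 hy.2 hxy with h2 | h2
  · exact Or.inl (threeCycle_mul_sq_of_apply_eq hs ht h hx.1 (h1.trans h2.symm))
  · refine Or.inr (threeCycle_mul_sq_of_apply_eq hs ht' h' hx.1 ?_)
    rw [h1, Perm.eq_inv_iff_eq, h2]
  · refine Or.inr (threeCycle_mul_sq_of_apply_eq hs ht' h' hy.1 ?_)
    rw [h1, Perm.eq_inv_iff_eq, h2]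
  · exact Or.inl (threeCycle_mul_sq_of_apply_eq hs ht h hy.1 (h1.trans h2.symm))

lemma threeCycle_pow_three {s : Perm α} (hs : s.IsThreeCycle) : s ^ 3 = 1 := by
  rw [← hs.orderOf]; exact pow_orderOf_eq_one s

lemma eq_inv_of_sq_mul_sq {G : Type*} [Group G] {s t : G} (hs : s ^ 3 = 1) (ht : t ^ 3 = 1)
    (h : s ^ 2 * t ^ 2 = 1) : t = s⁻¹ := by
  have h1 : s ^ 2 = s⁻¹ := by rw [eq_inv_iff_mul_eq_one, ← pow_succ, hs]
  have h2 : t ^ 2 = t⁻¹ := by rw [eq_inv_iff_mul_eq_one, ← pow_succ, ht]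
  rw [h1, h2, ← mul_inv_rev, inv_eq_one] at h
  exact eq_inv_of_mul_eq_one_left h

lemma threeCycle_inter_card_le {s t : Perm α} (hs : s.IsThreeCycle) :
    (s.support ∩ t.support).card ≤ 3 := by
  rw [← hs.card_support]; exact Finset.card_le_card Finset.inter_subset_left

lemma threeCycle_inter_eq_zero_iff {s t : Perm α} (hs : s.IsThreeCycle) (ht : t.IsThreeCycle) :
    (s.support ∩ t.support).card = 0 ↔ Commute s t ∧ ¬ (t = s ∨ t = s⁻¹) := by
  have s3 := threeCycle_pow_three hs
  have t3 := threeCycle_pow_three ht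
  have t3' : t⁻¹ ^ 3 = 1 := by rw [inv_pow, t3, inv_one]
  rw [← threeCycle_inter_eq_three_iff hs ht]
  constructor
  · intro h
    refine ⟨?_, by omega⟩
    apply Perm.Disjoint.commute
    rw [disjoint_iff_disjoint_support, Finset.disjoint_iff_inter_eq_empty]
    exact Finset.card_eq_zero.mp h
  · rintro ⟨hc, h3⟩
    have hle := threeCycle_inter_card_le (t := t) hs
    rw [threeCycle_inter_eq_three_iff hs ht] at h3
    push Not at h3
    by_contra h0
    have h3' := mt (threeCycle_inter_eq_three_iff hs ht).mp (by simpa using h3)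
    rcases (by omega : (s.support ∩ t.support).card = 1 ∨ (s.support ∩ t.support).card = 2)
      with h | h
    · have := threeCycle_mul_pow_five hs ht h
      rw [hc.mul_pow] at this
      apply h3.2
      apply eq_inv_of_sq_mul_sq s3 t3
      calc s ^ 2 * t ^ 2 = s ^ 3 * s ^ 2 * (t ^ 3 * t ^ 2) := by rw [s3, t3, one_mul, one_mul]
        _ = s ^ 5 * t ^ 5 := by rw [← pow_add, ← pow_add]
        _ = 1 := this
    · rcases threeCycle_mul_sq_of_inter_eq_two hs ht h with h | h
      · rw [hc.mul_pow] at h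
        exact h3.2 (eq_inv_of_sq_mul_sq s3 t3 h)
      · rw [hc.inv_right.mul_pow] at h
        exact h3.1 (inv_injective (eq_inv_of_sq_mul_sq s3 t3' h))

lemma threeCycle_inter_eq_one_iff {s t : Perm α} (hs : s.IsThreeCycle) (ht : t.IsThreeCycle) :
    (s.support ∩ t.support).card = 1 ↔
      (s * t) ^ 5 = 1 ∧ (s * t⁻¹) ^ 5 = 1 ∧ ¬ Commute s t := by
  have key : ∀ g : Perm α, g ^ 2 = 1 → g ^ 5 = 1 → g = 1 := by
    intro g h2 h5
    calc g = (g ^ 2) ^ 2 * g := by rw [h2, one_pow, one_mul]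
      _ = 1 := by rw [← pow_mul, ← pow_succ]; exact h5
  have hle := threeCycle_inter_card_le (t := t) hs
  constructor
  · intro h
    refine ⟨threeCycle_mul_pow_five hs ht h,
      threeCycle_mul_pow_five hs ht.inv (by rwa [support_inv]), fun hc => ?_⟩
    have h3 := mt (threeCycle_inter_eq_three_iff hs ht).mpr (by omega)
    have := (threeCycle_inter_eq_zero_iff hs ht).mpr ⟨hc, h3⟩
    omega
  · rintro ⟨h1, h2, hc⟩
    have h0 : (s.support ∩ t.support).card ≠ 0 := fun h =>
      hc ((threeCycle_inter_eq_zero_iff hs ht).mp h).1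
    have h3 : (s.support ∩ t.support).card ≠ 3 := fun h => hc (by
      rcases (threeCycle_inter_eq_three_iff hs ht).mp h with rfl | rfl
      · exact Commute.refl _
      · exact (Commute.refl s).inv_right)
    have h2 : (s.support ∩ t.support).card ≠ 2 := fun h => hc (by
      rcases threeCycle_mul_sq_of_inter_eq_two hs ht h with h' | h'
      · rw [eq_inv_of_mul_eq_one_left (key _ h' h1)]; exact (Commute.refl t).inv_left
      · rw [eq_inv_of_mul_eq_one_left (key _ h' h2), inv_inv])
    omega

end ThreeCycles

/-! ### Automorphisms of alternating groups -/

section AltAut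

open scoped Nat

/-- Up to the factor two lost in passing to the alternating group, products of `k ≥ 2` disjoint
three-cycles on `3 * k + r ≥ 7` points have a smaller centralizer than a three-cycle. -/
lemma two_mul_factorial_lt (k r : ℕ) (hk : 2 ≤ k) (h : 7 ≤ 3 * k + r) :
    2 * (r ! * 3 ^ k * k !) < (3 * k + r - 3)! * 3 := by
  induction k, hk using Nat.le_induction with
  | base =>
    have : 3 * 2 + r - 3 = r + 3 := by omega
    have h2 : 2 ! = 2 := rfl
    rw [this, h2, Nat.factorial_succ, Nat.factorial_succ, Nat.factorial_succ]
    have hr := Nat.factorial_pos r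
    have : 24 * r ! ≤ (r + 2 + 1) * ((r + 1 + 1) * ((r + 1) * r !)) := by
      rw [← mul_assoc, ← mul_assoc]
      apply Nat.mul_le_mul_right
      have h1 : 1 ≤ r := by omega
      calc 24 = (1 + 2 + 1) * (1 + 1 + 1) * (1 + 1) := rfl
        _ ≤ _ := by gcongr
    omega
  | succ k hk ih =>
    rcases Nat.lt_or_ge (3 * k + r) 7 with h7 | h7
    · obtain ⟨rfl, rfl⟩ : k = 2 ∧ r = 0 := by omega
      decide
    · have e : 3 * (k + 1) + r - 3 = (3 * k + r - 3) + 3 := by omega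
      rw [e, Nat.factorial_succ, Nat.factorial_succ, Nat.factorial_succ, Nat.factorial_succ,
        pow_succ]
      set A := (3 * k + r - 3)!
      set x := 3 * k + r - 3 with hx
      have h1 : (k + 1) * 3 ≤ (x + 2 + 1) * ((x + 1 + 1) * (x + 1)) := by
        have h1 : k + 1 ≤ x + 1 := by omega
        have h2 : 3 ≤ (x + 2 + 1) * (x + 1 + 1) := by nlinarith
        calc (k + 1) * 3 ≤ (x + 1) * ((x + 2 + 1) * (x + 1 + 1)) := Nat.mul_le_mul h1 h2
          _ = _ := by ring
      calc 2 * (r ! * (3 ^ k * 3) * ((k + 1) * k !)) =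
            (k + 1) * 3 * (2 * (r ! * 3 ^ k * k !)) := by ring
        _ < (k + 1) * 3 * (A * 3) := Nat.mul_lt_mul_of_pos_left (ih h7) (by omega)
        _ ≤ (x + 2 + 1) * ((x + 1 + 1) * (x + 1)) * (A * 3) := Nat.mul_le_mul_right _ h1
        _ = _ := by ring

lemma card_centralizer_alternating_le {α : Type*} [Fintype α] [DecidableEq α]
    (σ : alternatingGroup α) :
    Nat.card (Subgroup.centralizer {σ}) ≤ Nat.card (Subgroup.centralizer {(σ : Perm α)}) := by
  apply Nat.card_le_card_of_injective (fun g : Subgroup.centralizer {σ} =>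
    (⟨g.1.1, by
      have := g.2
      rw [Subgroup.mem_centralizer_singleton_iff] at this ⊢
      exact congrArg Subtype.val this⟩ : Subgroup.centralizer {(σ : Perm α)}))
  intro a b hab
  exact Subtype.ext (Subtype.ext (congrArg (fun x => x.1) hab))

/-- The centralizer in the alternating group has index at most two in the full centralizer. -/
lemma card_centralizer_le_two_mul {α : Type*} [Fintype α] [DecidableEq α] [Nontrivial α]
    (σ : alternatingGroup α) :
    Nat.card (Subgroup.centralizer {(σ : Perm α)}) ≤ 2 * Nat.card (Subgroup.centralizer {σ}) := by
  set C := Subgroup.centralizer {(σ : Perm α)}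
  have h1 : Nat.card C = Nat.card ((alternatingGroup α).subgroupOf C) *
      ((alternatingGroup α).subgroupOf C).index := (Subgroup.card_mul_index _).symm
  have h2 : ((alternatingGroup α).subgroupOf C).index ≤ 2 := by
    rw [← alternatingGroup.index_eq_two (α := α)]
    exact Nat.le_of_dvd (Nat.pos_of_ne_zero Subgroup.FiniteIndex.index_ne_zero)
      (Subgroup.relIndex_dvd_index_of_normal _ _)
  have h3 : Nat.card ((alternatingGroup α).subgroupOf C) ≤
      Nat.card (Subgroup.centralizer {σ}) := by
    apply Nat.card_le_card_of_injective (fun g : (alternatingGroup α).subgroupOf C =>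
      (⟨⟨g.1.1, g.2⟩, by
        have := g.1.2
        rw [Subgroup.mem_centralizer_singleton_iff] at this ⊢
        exact Subtype.ext this⟩ : Subgroup.centralizer {σ}))
    intro a b hab
    exact Subtype.ext (Subtype.ext (congrArg (fun x => x.1.1) hab))
  rw [h1, mul_comm]
  exact Nat.mul_le_mul h2 h3

lemma card_centralizer_mulAut {G : Type*} [Group G] (a : MulAut G) (g : G) :
    Nat.card (Subgroup.centralizer {a g}) = Nat.card (Subgroup.centralizer {g}) := by
  symm
  apply Nat.card_congr
  refine a.toEquiv.subtypeEquiv fun x => ?_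
  rw [Subgroup.mem_centralizer_singleton_iff, Subgroup.mem_centralizer_singleton_iff]
  change _ ↔ a x * a g = a g * a x
  rw [← map_mul, ← map_mul, a.injective.eq_iff]

variable {n : ℕ}

/-- Automorphisms of `A_n` preserve the class of three-cycles, for `n ≥ 5` and `n ≠ 6`. -/
theorem isThreeCycle_mulAut (hn : 5 ≤ n) (hn6 : n ≠ 6) (a : MulAut (alternatingGroup (Fin n)))
    {σ : alternatingGroup (Fin n)} (hσ : (σ : Perm (Fin n)).IsThreeCycle) :
    (a σ : Perm (Fin n)).IsThreeCycle := by
  have : Nontrivial (Fin n) := Fin.nontrivial_iff_two_le.mpr (by omega)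
  have hord : orderOf (a σ : Perm (Fin n)) = 3 := by
    rw [Subgroup.orderOf_coe, MulEquiv.orderOf_eq, ← Subgroup.orderOf_coe, hσ.orderOf]
  obtain ⟨k, hk⟩ := cycleType_prime_order (σ := (a σ : Perm (Fin n))) (by rw [hord]; norm_num)
  rw [hord] at hk
  rcases Nat.eq_zero_or_pos k with rfl | hkpos
  · simpa [IsThreeCycle] using hk
  exfalso
  have hsum : 3 * (k + 1) ≤ n := by
    have h1 := sum_cycleType (a σ : Perm (Fin n))
    have h2 := Finset.card_le_univ (a σ : Perm (Fin n)).support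
    rw [hk] at h1
    simp at h1 h2
    omega
  have h1 := card_centralizer_le_two_mul σ
  have h2 := card_centralizer_alternating_le (a σ)
  rw [card_centralizer_mulAut] at h2
  have h3 := h1.trans (Nat.mul_le_mul_left 2 h2)
  rw [nat_card_centralizer, nat_card_centralizer, hk, hσ.cycleType,
    Multiset.toFinset_replicate, if_neg (by omega)] at h3
  simp only [Multiset.sum_replicate, Multiset.prod_replicate, Finset.prod_singleton,
    Multiset.count_replicate_self, Fintype.card_fin, Multiset.sum_singleton,
    Multiset.prod_singleton, Multiset.toFinset_singleton, Multiset.count_singleton_self,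
    Nat.factorial_one, mul_one, smul_eq_mul] at h3
  obtain ⟨r, rfl⟩ := Nat.exists_eq_add_of_le hsum
  have := two_mul_factorial_lt (k + 1) r (by omega) (by omega)
  have e : 3 * (k + 1) + r - (k + 1) * 3 = r := by omega
  rw [e] at h3
  omega

/-- Automorphisms of `A_n` preserve how many points two three-cycles have in common. -/
lemma threeCycle_inter_card_mulAut (hn : 5 ≤ n) (hn6 : n ≠ 6)
    (a : MulAut (alternatingGroup (Fin n))) {s t : alternatingGroup (Fin n)}
    (hs : (s : Perm (Fin n)).IsThreeCycle) (ht : (t : Perm (Fin n)).IsThreeCycle) :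
    ((a s : Perm (Fin n)).support ∩ (a t : Perm (Fin n)).support).card =
      ((s : Perm (Fin n)).support ∩ (t : Perm (Fin n)).support).card := by
  have hs' := isThreeCycle_mulAut hn hn6 a hs
  have ht' := isThreeCycle_mulAut hn hn6 a ht
  have e3 : ((a t : Perm (Fin n)) = a s ∨ (a t : Perm (Fin n)) = (a s : Perm (Fin n))⁻¹) ↔
      ((t : Perm (Fin n)) = s ∨ (t : Perm (Fin n)) = (s : Perm (Fin n))⁻¹) := by
    norm_cast
    rw [← map_inv, a.injective.eq_iff, a.injective.eq_iff]
  have ec : Commute (a s : Perm (Fin n)) (a t) ↔ Commute (s : Perm (Fin n)) t := by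
    unfold Commute SemiconjBy
    norm_cast
    rw [← map_mul, ← map_mul, a.injective.eq_iff]
  have e5 : ((a s : Perm (Fin n)) * a t) ^ 5 = 1 ↔ ((s : Perm (Fin n)) * t) ^ 5 = 1 := by
    norm_cast
    rw [← map_mul, ← map_pow, map_eq_one_iff a a.injective]
  have e5' : ((a s : Perm (Fin n)) * (a t : Perm (Fin n))⁻¹) ^ 5 = 1 ↔
      ((s : Perm (Fin n)) * (t : Perm (Fin n))⁻¹) ^ 5 = 1 := by
    norm_cast
    rw [← map_inv, ← map_mul, ← map_pow, map_eq_one_iff a a.injective]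
  have h3 := threeCycle_inter_eq_three_iff hs' ht'
  have h0 := threeCycle_inter_eq_zero_iff hs' ht'
  have h1 := threeCycle_inter_eq_one_iff hs' ht'
  rw [e3, ← threeCycle_inter_eq_three_iff hs ht] at h3
  rw [ec, e3, ← threeCycle_inter_eq_zero_iff hs ht] at h0
  rw [e5, e5', ec, ← threeCycle_inter_eq_one_iff hs ht] at h1
  have := threeCycle_inter_card_le (t := (t : Perm (Fin n))) hs
  have := threeCycle_inter_card_le (t := (a t : Perm (Fin n))) hs'
  omega

open scoped Classical in
/-- The number of three-cycles moving both `x` and `y`. -/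
noncomputable def threeCycleCount {n : ℕ} (x y : Fin n) : ℕ :=
  (Finset.univ.filter fun t : Perm (Fin n) => t.IsThreeCycle ∧ x ∈ t.support ∧ y ∈ t.support).card

lemma threeCycleCount_apply (p : Perm (Fin n)) (x y : Fin n) :
    threeCycleCount (p x) (p y) = threeCycleCount x y := by
  unfold threeCycleCount
  symm
  apply Finset.card_equiv (MulAut.conj p).toEquiv
  intro t
  have : (MulAut.conj p).toEquiv t = p * t * p⁻¹ := rfl
  rw [this]
  simp [IsThreeCycle]

/-- At least four points are needed: on three points, all three-cycles move all points. -/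
lemma threeCycleCount_lt (hn : 4 ≤ n) {x y : Fin n} (hxy : x ≠ y) :
    threeCycleCount x y < threeCycleCount x x := by
  obtain ⟨z, w, hz, hw, hzw⟩ : ∃ z w : Fin n, z ∉ ({x, y} : Finset (Fin n)) ∧
      w ∉ ({x, y} : Finset (Fin n)) ∧ z ≠ w := by
    have : 1 < (({x, y} : Finset (Fin n))ᶜ).card := by
      rw [Finset.card_compl, Fintype.card_fin, Finset.card_pair hxy]; omega
    obtain ⟨z, hz, w, hw, hzw⟩ := Finset.one_lt_card.mp this
    exact ⟨z, w, by simpa using hz, by simpa using hw, hzw⟩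
  simp only [Finset.mem_insert, Finset.mem_singleton, not_or] at hz hw
  apply Finset.card_lt_card
  rw [Finset.ssubset_iff_of_subset]
  · refine ⟨swap x z * swap x w, ?_, ?_⟩
    · simp only [Finset.mem_filter, Finset.mem_univ, true_and, and_self, mem_support]
      refine ⟨isThreeCycle_swap_mul_swap_same (Ne.symm hz.1) (Ne.symm hw.1) hzw, ?_⟩
      rw [Perm.mul_apply, swap_apply_left, swap_apply_of_ne_of_ne hw.1 hzw.symm]
      exact hw.1
    · simp only [Finset.mem_filter, Finset.mem_univ, true_and, mem_support, not_and, not_not]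
      intro _ _
      rw [Perm.mul_apply, swap_apply_of_ne_of_ne hxy.symm (Ne.symm hw.2),
        swap_apply_of_ne_of_ne hxy.symm (Ne.symm hz.2)]
  · intro t ht
    simp only [Finset.mem_filter, Finset.mem_univ, true_and] at ht ⊢
    exact ⟨ht.1, ht.2.1, ht.2.1⟩

lemma exists_perm_apply_pair {x y x' y' : Fin n} (h : x ≠ y) (h' : x' ≠ y') :
    ∃ p : Perm (Fin n), p x = x' ∧ p y = y' := by
  refine ⟨swap (swap x x' y) y' * swap x x', ?_, ?_⟩
  · have : x' ≠ swap x x' y := by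
      intro hc
      have := congrArg (swap x x') hc
      rw [swap_apply_right, swap_apply_self] at this
      exact h this
    rw [Perm.mul_apply, swap_apply_left, swap_apply_of_ne_of_ne this h']
  · rw [Perm.mul_apply, swap_apply_left]

open scoped Classical in
/-- Summing over all three-cycles `t` the number of common points of `t` and `σ t σ⁻¹`
counts the points moved by `σ`, up to an affine transformation. -/
lemma sum_threeCycle_inter_conj (σ : Perm (Fin n)) :
    ∑ t : Perm (Fin n) with t.IsThreeCycle, (t.support ∩ (σ * t * σ⁻¹).support).card =
      ∑ x, threeCycleCount x (σ x) := by
  have h : ∀ t : Perm (Fin n), (t.support ∩ (σ * t * σ⁻¹).support).card =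
      ∑ x, if x ∈ t.support ∧ σ x ∈ t.support then 1 else 0 := by
    intro t
    rw [Finset.sum_boole, Nat.cast_id]
    symm
    apply Finset.card_equiv σ
    intro x
    simp [and_comm]
  simp_rw [h]
  rw [Finset.sum_comm]
  apply Finset.sum_congr rfl
  intro x _
  rw [Finset.sum_boole, Nat.cast_id, threeCycleCount, Finset.filter_filter]

open scoped Classical in
/-- Automorphisms of `A_n` preserve the number of moved points, for `n ≥ 5` and `n ≠ 6`. -/
theorem card_support_mulAut (hn : 5 ≤ n) (hn6 : n ≠ 6) (a : MulAut (alternatingGroup (Fin n)))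
    (σ : alternatingGroup (Fin n)) :
    (a σ : Perm (Fin n)).support.card = (σ : Perm (Fin n)).support.card := by
  let x₀ : Fin n := ⟨0, by omega⟩
  let y₀ : Fin n := ⟨1, by omega⟩
  have hxy : x₀ ≠ y₀ := by simp [x₀, y₀]
  have hlt := threeCycleCount_lt (by omega) hxy
  have hsum : ∀ τ : Perm (Fin n), (∑ x, threeCycleCount x (τ x)) +
      τ.support.card * (threeCycleCount x₀ x₀ - threeCycleCount x₀ y₀) =
        n * threeCycleCount x₀ x₀ := by
    intro τ
    have : ∀ x, threeCycleCount x (τ x) + (if x ∈ τ.support then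
        (threeCycleCount x₀ x₀ - threeCycleCount x₀ y₀) else 0) = threeCycleCount x₀ x₀ := by
      intro x
      by_cases hx : τ x = x
      · have hx' : x ∉ τ.support := by simpa using hx
        rw [if_neg hx', hx, add_zero, ← threeCycleCount_apply (swap x x₀) x x, swap_apply_left]
      · have hx' : x ∈ τ.support := by simpa using hx
        obtain ⟨p, hp1, hp2⟩ := exists_perm_apply_pair (Ne.symm hx) hxy
        rw [if_pos hx', ← threeCycleCount_apply p x (τ x), hp1, hp2]
        omega
    have h2 := Finset.sum_congr (rfl : (Finset.univ : Finset (Fin n)) = Finset.univ)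
      fun x _ => this x
    rw [Finset.sum_add_distrib, ← Finset.sum_filter, Finset.sum_const, Finset.sum_const,
      Finset.filter_mem_eq_inter, Finset.univ_inter] at h2
    simpa only [smul_eq_mul, Finset.card_univ, Fintype.card_fin] using h2
  have hinv : (∑ x, threeCycleCount x ((a σ : Perm (Fin n)) x)) =
      ∑ x, threeCycleCount x ((σ : Perm (Fin n)) x) := by
    rw [← sum_threeCycle_inter_conj, ← sum_threeCycle_inter_conj]
    symm
    refine Finset.sum_bij
      (fun t ht => (a ⟨t, (Finset.mem_filter.mp ht).2.mem_alternatingGroup⟩ : Perm (Fin n)))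
      ?_ ?_ ?_ ?_
    · intro t ht
      exact Finset.mem_filter.mpr ⟨Finset.mem_univ _, isThreeCycle_mulAut hn hn6 a
        (Finset.mem_filter.mp ht).2⟩
    · intro t ht u hu h
      exact congrArg Subtype.val (a.injective (Subtype.ext h))
    · intro t ht
      have ht3 := (Finset.mem_filter.mp ht).2
      refine ⟨(a⁻¹ ⟨t, ht3.mem_alternatingGroup⟩ : alternatingGroup (Fin n)), ?_, ?_⟩
      · exact Finset.mem_filter.mpr ⟨Finset.mem_univ _, isThreeCycle_mulAut hn hn6 a⁻¹ ht3⟩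
      · simp
    · intro t ht
      have ht3 := (Finset.mem_filter.mp ht).2
      set u : alternatingGroup (Fin n) := ⟨t, ht3.mem_alternatingGroup⟩
      have hconj : ((σ * u * σ⁻¹ : alternatingGroup (Fin n)) : Perm (Fin n)).IsThreeCycle := by
        have : (σ : Perm (Fin n)) * t * (σ : Perm (Fin n))⁻¹ =
          ((σ * u * σ⁻¹ : alternatingGroup (Fin n)) : Perm (Fin n)) := rfl
        rw [← this, IsThreeCycle, cycleType_conj]; exact ht3
      have := threeCycle_inter_card_mulAut hn hn6 a (s := u) ht3 hconj
      rw [map_mul, map_mul, map_inv] at this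
      exact this.symm
  have h1 := hsum (a σ)
  rw [hinv, ← hsum σ] at h1
  exact Nat.eq_of_mul_eq_mul_right (by omega) (Nat.add_left_cancel h1)

end AltAut

/-! ### Generating the alternating group -/

section Generation

open scoped Pointwise

/-- `y` moves exactly `N` points, and each of them lies in a `y`-orbit of length at least `l`. -/
def HasLongOrbits {α : Type*} [Fintype α] [DecidableEq α] (y : Perm α) (N l : ℕ) : Prop :=
  y.support.card = N ∧ ∀ z ∈ y.support, ∀ k, 0 < k → k < l → (y ^ k) z ≠ z

lemma HasLongOrbits.le_ncard {α : Type*} [Fintype α] [DecidableEq α] {y : Perm α} {N l : ℕ}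
    (hy : HasLongOrbits y N l) {s : Set α} (hs : ∀ x ∈ s, y x ∈ s) {z : α} (hz : z ∈ y.support)
    (hzs : z ∈ s) : l ≤ (s ∩ y.support).ncard := by
  have hpow : ∀ k, (y ^ k) z ∈ s ∩ y.support := by
    intro k
    induction k with
    | zero => exact ⟨hzs, by simpa using hz⟩
    | succ k ih =>
      rw [pow_succ', Perm.mul_apply]
      exact ⟨hs _ ih.1, by simpa using ih.2⟩
  have hinj : ∀ i j, i < j → j < l → (y ^ i) z ≠ (y ^ j) z := by
    intro i j hij hj h
    apply hy.2 z hz (j - i) (by omega) (by omega)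
    apply (y ^ i).injective
    rw [← Perm.mul_apply, ← pow_add, Nat.add_sub_cancel' hij.le, h]
  have hfin : ((Finset.range l).image fun k => (y ^ k) z).card = l := by
    rw [Finset.card_image_of_injOn, Finset.card_range]
    intro i hi j hj hij
    simp only [Finset.coe_range, Set.mem_Iio] at hi hj
    rcases lt_trichotomy i j with h | h | h
    · exact absurd hij (hinj i j h hj)
    · exact h
    · exact absurd hij.symm (hinj j i h hi)
  rw [← hfin, ← Set.ncard_coe_finset]
  apply Set.ncard_le_ncard _ (Set.toFinite _)
  intro x hx
  simp only [Finset.coe_image, Set.mem_image] at hx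
  obtain ⟨k, _, rfl⟩ := hx
  exact hpow k

variable {n : ℕ}

lemma hasLongOrbits_of_card_support_pow {y : Perm (Fin n)} {l : ℕ}
    (h : ∀ k, 0 < k → k < l → (y ^ k).support.card = y.support.card) :
    HasLongOrbits y y.support.card l := by
  refine ⟨rfl, fun z hz k hk hkl => ?_⟩
  rw [← Finset.eq_of_subset_of_card_le (support_pow_le y k) (h k hk hkl).ge] at hz
  simpa using hz

/-- A subgroup `U` of `S_n` is *abundant* if each even permutation that does not have exactly one
fixed point is matched by an element of `U` all of whose powers move as many points as the
corresponding powers of the given permutation. -/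
def IsAbundant (U : Subgroup (Perm (Fin n))) : Prop :=
  ∀ s ∈ alternatingGroup (Fin n), s.support.card + 1 ≠ n →
    ∃ y ∈ U, ∀ k, (y ^ k).support.card = (s ^ k).support.card

lemma exists_isCycle (l : ℕ) (hl : 2 ≤ l) (hln : l ≤ n) :
    ∃ c : Perm (Fin n), c.IsCycle ∧ c.support.card = l := by
  obtain ⟨c, hc⟩ := (exists_with_cycleType_iff (α := Fin n) (m := {l})).mpr
    ⟨by simpa using hln, by simpa using hl⟩
  refine ⟨c, ?_, ?_⟩
  · rw [← card_cycleType_eq_one, hc, Multiset.card_singleton]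
  · rw [← sum_cycleType, hc, Multiset.sum_singleton]

lemma IsAbundant.exists_odd {U : Subgroup (Perm (Fin n))} (hU : IsAbundant U) (l : ℕ)
    (hl : 2 ≤ l) (hodd : Odd l) (hln : l ≤ n) (hl1 : l + 1 ≠ n) :
    ∃ y ∈ U, HasLongOrbits y l l := by
  obtain ⟨c, hc, hcl⟩ := exists_isCycle l hl hln
  obtain ⟨y, hyU, hy⟩ := hU c
    (by rw [mem_alternatingGroup, hc.sign, hcl, hodd.neg_one_pow, neg_neg]) (by omega)
  have h1 : y.support.card = l := by simpa [hcl] using hy 1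
  refine ⟨y, hyU, ?_⟩
  have := hasLongOrbits_of_card_support_pow (y := y) (l := l) ?_
  · rwa [h1] at this
  · intro k hk hkl
    rw [hy k, h1, hc.support_pow_of_pos_of_lt_orderOf hk (by rwa [hc.orderOf, hcl]), hcl]

/-- The square of an `n`-cycle is an even permutation without fixed points, all of whose orbits have
length at least `n / 2`. -/
lemma IsAbundant.exists_half {U : Subgroup (Perm (Fin n))} (hU : IsAbundant U)
    (hn : 3 ≤ n) : ∃ y ∈ U, HasLongOrbits y n (n / 2) := by
  obtain ⟨c, hc, hcl⟩ := exists_isCycle n (by omega) le_rfl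
  have hpow : ∀ k, 0 < k → k < n → (c ^ k).support.card = n := by
    intro k hk hkn
    rw [hc.support_pow_of_pos_of_lt_orderOf hk (by rwa [hc.orderOf, hcl]), hcl]
  have h2 := hpow 2 (by norm_num) (by omega)
  obtain ⟨y, hyU, hy⟩ := hU (c ^ 2) (by
    rw [mem_alternatingGroup, map_pow, Int.units_sq]) (by omega)
  have h1 : y.support.card = n := by simpa [h2] using hy 1
  refine ⟨y, hyU, ?_⟩
  have := hasLongOrbits_of_card_support_pow (y := y) (l := n / 2) ?_
  · rwa [h1] at this
  · intro k hk hkl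
    rw [hy k, h1, ← pow_mul, hpow _ (by omega) (by omega)]

lemma IsAbundant.isPretransitive {U : Subgroup (Perm (Fin n))} (hU : IsAbundant U)
    (hn : 5 ≤ n) (hn6 : n ≠ 6) : MulAction.IsPretransitive U (Fin n) := by
  have horb : ∀ (z : Fin n), ∀ y ∈ U, ∀ x ∈ MulAction.orbit U z, y x ∈ MulAction.orbit U z := by
    intro z y hy x hx
    exact MulAction.mem_orbit_of_mem_orbit (⟨y, hy⟩ : U) hx
  have hlarge : ∀ y ∈ U, ∀ N l, HasLongOrbits y N l → ∀ z ∈ y.support,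
      l ≤ (MulAction.orbit U z).ncard := by
    intro y hy N l h z hz
    exact (h.le_ncard (horb z y hy) hz (MulAction.mem_orbit_self z)).trans
      (Set.ncard_le_ncard Set.inter_subset_left (Set.toFinite _))
  have hsupp : ∀ y : Perm (Fin n), y.support.card = n → ∀ z, z ∈ y.support := by
    intro y hy z
    rw [(Finset.card_eq_iff_eq_univ _).mp (hy.trans (Fintype.card_fin n).symm)]
    exact Finset.mem_univ z
  suffices ∃ w : Fin n, MulAction.orbit U w = Set.univ by
    obtain ⟨w, hw⟩ := this
    exact (MulAction.isPretransitive_iff_orbit_eq_univ w).mpr hw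
  rcases Nat.even_or_odd n with he | ho
  · -- All orbits have at least `n / 2` points, and one has at least `n - 3 > n / 2`.
    obtain ⟨y, hyU, hy⟩ := hU.exists_half (by omega)
    obtain ⟨m, hm⟩ := he
    obtain ⟨y', hyU', hy'⟩ :=
      hU.exists_odd (n - 3) (by omega) ⟨m - 2, by omega⟩ (by omega) (by omega)
    obtain ⟨w, hw⟩ : y'.support.Nonempty := by rw [← Finset.card_pos, hy'.1]; omega
    have h1 := hlarge y' hyU' _ _ hy' w hw
    refine ⟨w, Set.eq_univ_of_forall fun z => ?_⟩
    have h2 := hlarge y hyU _ _ hy z (hsupp y hy.1 z)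
    by_contra hz
    rcases MulAction.orbit.eq_or_disjoint (G := U) z w with h | h
    · exact hz (h ▸ MulAction.mem_orbit_self z)
    · have h3 := Set.ncard_union_eq h (Set.toFinite _) (Set.toFinite _)
      have h4 := Set.ncard_le_card (MulAction.orbit U z ∪ MulAction.orbit U w)
      rw [Nat.card_eq_fintype_card, Fintype.card_fin] at h4
      omega
  · obtain ⟨y, hyU, hy⟩ := hU.exists_odd n (by omega) ho le_rfl (by omega)
    have h1 := hlarge y hyU _ _ hy ⟨0, by omega⟩ (hsupp y hy.1 _)
    refine ⟨⟨0, by omega⟩, ?_⟩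
    rw [Set.eq_univ_iff_ncard, Nat.card_eq_fintype_card, Fintype.card_fin]
    refine le_antisymm ?_ h1
    have h4 := Set.ncard_le_card (MulAction.orbit U (⟨0, by omega⟩ : Fin n))
    rwa [Nat.card_eq_fintype_card, Fintype.card_fin] at h4

open scoped Classical in
/-- If all orbits on the moved points of some group element are at least as long as a block `B`, no
translate of `B` contains both fixed and moved points of it; so the fixed points are a union of
translates. -/
lemma ncard_block_dvd_card_fixed {U : Subgroup (Perm (Fin n))} [MulAction.IsPretransitive U (Fin n)]
    {B : Set (Fin n)} (hB : MulAction.IsBlock U B) (hne : B.Nonempty) {y : Perm (Fin n)}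
    (hyU : y ∈ U) {N l : ℕ} (hy : HasLongOrbits y N l) (hBl : B.ncard ≤ l) :
    B.ncard ∣ n - N := by
  obtain ⟨b, hb⟩ := hne
  have hex : ∀ x : Fin n, ∃ g : U, x ∈ g • B := by
    intro x
    obtain ⟨g, hg⟩ := MulAction.exists_smul_eq U b x
    exact ⟨g, hg ▸ Set.smul_mem_smul_set hb⟩
  choose g hg using hex
  have huniq : ∀ x x', x' ∈ g x • B → g x' • B = g x • B := by
    intro x x' hx'
    by_contra h
    exact Set.disjoint_left.mp (hB h) (hg x') hx'
  have hfix : ∀ x, y x = x → ∀ x' ∈ g x • B, y x' = x' := by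
    intro x hx x' hx'
    by_contra hne
    have hyB : y • (g x • B) = g x • B := by
      have h1 : (⟨y, hyU⟩ * g x : U) • B = y • (g x • B) := by rw [mul_smul]; rfl
      by_contra h
      rw [← h1] at h
      refine Set.disjoint_left.mp (hB h) ?_ (hg x)
      rw [h1]
      exact ⟨x, hg x, hx⟩
    have hmem : ∀ z ∈ g x • B, y z ∈ g x • B := by
      intro z hz
      rw [← hyB]; exact Set.smul_mem_smul_set hz
    have h2 := hy.le_ncard hmem (by simpa using hne) hx'
    have h3 : (g x • B ∩ y.support).ncard < (g x • B).ncard := by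
      apply Set.ncard_lt_ncard _ (Set.toFinite _)
      refine ⟨Set.inter_subset_left, fun h => ?_⟩
      have := (h (hg x)).2
      simp [hx] at this
    rw [Set.ncard_smul_set] at h3
    omega
  have hcard : n - N = (y.supportᶜ).card := by
    rw [Finset.card_compl, hy.1, Fintype.card_fin]
  rw [hcard, Finset.card_eq_sum_card_image (fun x => g x • B)]
  apply Finset.dvd_sum
  intro D hD
  obtain ⟨x, hx, rfl⟩ := Finset.mem_image.mp hD
  have hx' : y x = x := by simpa using hx
  apply dvd_of_eq
  rw [← Set.ncard_smul_set (g x) B, ← Set.ncard_coe_finset]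
  congr 1
  ext z
  simp only [Finset.coe_filter, Finset.mem_compl, mem_support, not_not, Set.mem_ofPred_eq]
  constructor
  · intro hz
    exact ⟨hfix x hx' z hz, huniq x z hz⟩
  · rintro ⟨_, hz⟩
    rw [← hz]; exact hg z

/-- An abundant subgroup contains the alternating group. -/
theorem IsAbundant.alternatingGroup_le {U : Subgroup (Perm (Fin n))} (hU : IsAbundant U)
    (hn : 5 ≤ n) (hn6 : n ≠ 6) : alternatingGroup (Fin n) ≤ U := by
  have := hU.isPretransitive hn hn6
  have hprim : MulAction.IsPreprimitive U (Fin n) := by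
    refine ⟨fun {B} hB => ?_⟩
    by_contra hcon
    rw [MulAction.IsTrivialBlock, not_or, Set.not_subsingleton_iff] at hcon
    obtain ⟨hnt, huniv⟩ := hcon
    have hne := hnt.nonempty
    have h1 : 2 ≤ B.ncard := Set.one_lt_ncard_iff_nontrivial.mpr hnt
    have h2 : B.ncard * 2 ≤ n := by
      by_contra h
      exact huniv (hB.eq_univ_of_card_lt (by simpa using h))
    have h3 : B.ncard ∣ n := by simpa using hB.ncard_dvd_card hne
    have key : ∀ l, 2 ≤ l → Odd l → l ≤ n → l + 1 ≠ n → B.ncard ≤ l → B.ncard ∣ n - l := by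
      intro l hl hodd hln hl1 hBl
      obtain ⟨y, hyU, hy⟩ := hU.exists_odd l hl hodd hln hl1
      exact ncard_block_dvd_card_fixed hB hne hyU hy hBl
    generalize B.ncard = b at *
    rcases Nat.even_or_odd n with ⟨m, hm⟩ | ho
    · -- A block size dividing `3` is excluded by a five-cycle.
      have h4 := key (n - 3) (by omega) ⟨m - 2, by omega⟩ (by omega) (by omega) (by omega)
      rw [show n - (n - 3) = 3 by omega, Nat.dvd_prime Nat.prime_three] at h4
      obtain rfl : b = 3 := by omega
      have h5 := key 5 (by omega) ⟨2, rfl⟩ (by omega) (by omega) (by omega)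
      omega
    · have ho' := ho
      obtain ⟨m, hm⟩ := ho
      have h4 := key (n - 2) (by omega) ⟨m - 1, by omega⟩ (by omega) (by omega) (by omega)
      rw [show n - (n - 2) = 2 by omega, Nat.dvd_prime Nat.prime_two] at h4
      obtain rfl : b = 2 := by omega
      omega
  obtain ⟨y, hyU, hy⟩ := hU.exists_odd 3 (by omega) ⟨1, rfl⟩ (by omega) (by omega)
  exact alternatingGroup_le_of_isPreprimitive_of_isThreeCycle_mem hprim
    (card_support_eq_three_iff.mp hy.1) hyU

end Generation

/-! ### Irreducible representations and their characters -/

section Representations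

lemma isIrreducible_toRepresentation {G V : Type*} [Monoid G] [AddCommGroup V] [Module ℂ V]
    {ρ : Representation ℂ G V} (S : Subrepresentation ρ) (h0 : S.toSubmodule ≠ ⊥)
    (h : ∀ T : Subrepresentation ρ, T.toSubmodule ≤ S.toSubmodule → T.toSubmodule ≠ ⊥ →
      S.toSubmodule ≤ T.toSubmodule) : S.toRepresentation.IsIrreducible := by
  have hnt : Nontrivial S.toSubmodule := Submodule.nontrivial_iff_ne_bot.mpr h0
  refine { exists_pair_ne := ⟨⊥, ⊤, fun hbt => ?_⟩, eq_bot_or_eq_top := fun T => ?_ }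
  · have : (⊥ : Submodule ℂ S.toSubmodule) = ⊤ := congrArg Subrepresentation.toSubmodule hbt
    exact bot_ne_top this
  · by_cases hT : T.toSubmodule = ⊥
    · exact Or.inl (Subrepresentation.toSubmodule_injective hT)
    · right
      apply Subrepresentation.toSubmodule_injective
      let T' : Subrepresentation ρ := ⟨T.toSubmodule.map S.toSubmodule.subtype, by
        rintro g _ ⟨v, hv, rfl⟩
        exact ⟨S.toRepresentation g v, T.apply_mem_toSubmodule g hv, rfl⟩⟩
      have hle : S.toSubmodule ≤ T'.toSubmodule := by
        apply h
        · rintro _ ⟨v, _, rfl⟩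
          exact v.2
        · intro hbot
          exact hT (Submodule.map_injective_of_injective (Submodule.injective_subtype _)
            (hbot.trans (Submodule.map_bot _).symm))
      change T.toSubmodule = ⊤
      rw [eq_top_iff]
      rintro v -
      obtain ⟨w, hw, hwv⟩ := hle v.2
      rwa [← Subtype.ext hwv]

/-- A nonzero subrepresentation contains an irreducible one. -/
lemma exists_irreducible_le {G V : Type*} [Monoid G] [AddCommGroup V] [Module ℂ V]
    [FiniteDimensional ℂ V] {ρ : Representation ℂ G V} (E : Subrepresentation ρ)
    (hE : E.toSubmodule ≠ ⊥) :
    ∃ S : Subrepresentation ρ, S.toSubmodule ≤ E.toSubmodule ∧ S.toSubmodule ≠ ⊥ ∧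
      S.toRepresentation.IsIrreducible := by
  obtain ⟨S, ⟨hSE, hS0⟩, hmin⟩ := WellFounded.has_min
    (InvImage.wf (fun T : Subrepresentation ρ => T.toSubmodule) wellFounded_lt)
    {T : Subrepresentation ρ | T.toSubmodule ≤ E.toSubmodule ∧ T.toSubmodule ≠ ⊥} ⟨E, le_rfl, hE⟩
  refine ⟨S, hSE, hS0, isIrreducible_toRepresentation S hS0 fun T hTS hT0 => ?_⟩
  by_contra hcon
  exact hmin T ⟨hTS.trans hSE, hT0⟩ (lt_of_le_not_ge hTS hcon)

/-- The permutation representation on the complex functions on a `G`-set. -/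
noncomputable def permRep (G X : Type*) [Group G] [MulAction G X] :
    Representation ℂ G (X → ℂ) where
  toFun g := LinearMap.funLeft ℂ ℂ (g⁻¹ • ·)
  map_one' := by ext; simp [LinearMap.funLeft]
  map_mul' g h := by
    ext v x
    simp [LinearMap.funLeft, mul_smul]

@[simp]
lemma permRep_apply {G X : Type*} [Group G] [MulAction G X] (g : G) (v : X → ℂ) (x : X) :
    permRep G X g v x = v (g⁻¹ • x) := rfl

lemma trace_pi {X : Type*} [Fintype X] [DecidableEq X] (f : (X → ℂ) →ₗ[ℂ] (X → ℂ)) :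
    LinearMap.trace ℂ _ f = ∑ x, f (Pi.single x 1) x := by
  rw [LinearMap.trace_eq_matrix_trace ℂ (Pi.basisFun ℂ X), Matrix.trace]
  simp

/-- **Frobenius' functional equation** for the character of an irreducible representation. -/
lemma char_one_mul_sum_char_conj_mul {G V : Type*} [Group G] [Fintype G] [AddCommGroup V]
    [Module ℂ V] [FiniteDimensional ℂ V] (ρ : Representation ℂ G V) (hρ : ρ.IsIrreducible)
    (a b : G) : ρ.character 1 * ∑ h : G, ρ.character (h * a * h⁻¹ * b) =
      Fintype.card G * (ρ.character a * ρ.character b) := by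
  let T : V →ₗ[ℂ] V := ∑ h : G, ρ (h * a * h⁻¹)
  have hT : ∀ g : G, T ∘ₗ ρ g = ρ g ∘ₗ T := by
    intro g
    change (∑ h : G, ρ (h * a * h⁻¹)) * ρ g = ρ g * (∑ h : G, ρ (h * a * h⁻¹))
    rw [Finset.sum_mul, Finset.mul_sum, ← Equiv.sum_comp (Equiv.mulLeft g)]
    refine Finset.sum_congr rfl fun h _ => ?_
    rw [← map_mul, ← map_mul]
    congr 1
    simp [mul_assoc]
  obtain ⟨c, hc⟩ :=
    (Representation.IsIrreducible.algebraMap_intertwiningMap_bijective_of_isAlgClosed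
    (ρ := ρ)).2 ⟨T, hT⟩
  have hTc : T = c • LinearMap.id := by
    have : T = (algebraMap ℂ (ρ.IntertwiningMap ρ) c).toLinearMap :=
      (congrArg Representation.IntertwiningMap.toLinearMap hc).symm
    rw [this]
    ext v
    simp [Algebra.algebraMap_eq_smul_one]
  have h1 : ∑ h : G, ρ.character (h * a * h⁻¹ * b) = c * ρ.character b := by
    calc ∑ h : G, ρ.character (h * a * h⁻¹ * b) = LinearMap.trace ℂ V (T * ρ b) := by
          simp only [T, Finset.sum_mul, map_sum, Representation.character, map_mul]
      _ = c * ρ.character b := by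
          rw [hTc]
          change LinearMap.trace ℂ V (c • ρ b) = _
          rw [map_smul, smul_eq_mul]; rfl
  have h2 : (Fintype.card G : ℂ) * ρ.character a = c * ρ.character 1 := by
    calc (Fintype.card G : ℂ) * ρ.character a = ∑ h : G, ρ.character (h * a * h⁻¹) := by
          simp
      _ = LinearMap.trace ℂ V T := by simp only [T, map_sum, Representation.character]
      _ = c * ρ.character 1 := by
          rw [hTc, map_smul, smul_eq_mul, Representation.character, map_one]; rfl
  linear_combination ρ.character 1 * h1 - ρ.character b * h2

end Representations

/-! ### The character of degree `n - 1` of the alternating group -/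

section NaturalCharacter

variable {n : ℕ}

lemma altChar_eq (σ : alternatingGroup (Fin n)) :
    altChar n σ = n - 1 - ((σ : Perm (Fin n)).support.card : ℂ) := by
  have h : Nat.card {i : Fin n // (σ : Perm (Fin n)) i = i} +
      (σ : Perm (Fin n)).support.card = n := by
    rw [Nat.card_eq_fintype_card, Fintype.card_subtype]
    have := Finset.card_filter_add_card_filter_not (s := (Finset.univ : Finset (Fin n)))
      (fun i => (σ : Perm (Fin n)) i = i)
    rw [Finset.card_univ, Fintype.card_fin] at this
    exact this
  unfold altChar
  rw [eq_sub_of_add_eq (by exact_mod_cast h :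
    (Nat.card {i : Fin n // (σ : Perm (Fin n)) i = i} : ℂ) +
      ((σ : Perm (Fin n)).support.card : ℂ) = n)]
  ring

lemma exists_alternating_apply (hn : 4 ≤ n) {a i j : Fin n} (hi : i ≠ a) (hj : j ≠ a) :
    ∃ h : alternatingGroup (Fin n), h • a = a ∧ h • i = j := by
  by_cases hij : i = j
  · exact ⟨1, by simp, by simp [hij]⟩
  obtain ⟨k, hk⟩ : ∃ k, k ∉ ({a, i, j} : Finset (Fin n)) := by
    by_contra! hc
    have h1 := Finset.card_le_three (a := a) (b := i) (c := j)
    rw [Finset.eq_univ_of_forall hc, Finset.card_univ, Fintype.card_fin] at h1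
    omega
  simp only [Finset.mem_insert, Finset.mem_singleton, not_or] at hk
  refine ⟨⟨swap i k * swap i j, (isThreeCycle_swap_mul_swap_same (Ne.symm hk.2.1) hij
    hk.2.2).mem_alternatingGroup⟩, ?_, ?_⟩
  · change swap i k (swap i j a) = a
    rw [swap_apply_of_ne_of_ne hi.symm hj.symm, swap_apply_of_ne_of_ne hi.symm (Ne.symm hk.1)]
  · change swap i k (swap i j i) = j
    rw [swap_apply_left, swap_apply_of_ne_of_ne (Ne.symm hij) (Ne.symm hk.2.2)]

/-- The vectors with coordinate sum zero, as a subrepresentation of `ℂ^n` under `A_n`. -/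
noncomputable def sumZero (n : ℕ) :
    Subrepresentation (permRep (alternatingGroup (Fin n)) (Fin n)) where
  toSubmodule := LinearMap.ker (∑ i : Fin n, (LinearMap.proj i : (Fin n → ℂ) →ₗ[ℂ] ℂ))
  apply_mem_toSubmodule g v hv := by
    simp only [LinearMap.mem_ker, LinearMap.sum_apply, LinearMap.proj_apply, permRep_apply] at hv ⊢
    rw [← hv]
    exact Equiv.sum_comp (MulAction.toPerm g⁻¹) v

lemma mem_sumZero {v : Fin n → ℂ} : v ∈ (sumZero n).toSubmodule ↔ ∑ i, v i = 0 := by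
  simp [sumZero]

/-- Averaging a nonzero vector over a point stabilizer, which is transitive on the remaining
points, gives a multiple of `n e_a - (1, …, 1)`; these vectors span. -/
lemma isIrreducible_sumZero (hn : 4 ≤ n) : (sumZero n).toRepresentation.IsIrreducible := by
  classical
  have hn0 : (n : ℂ) ≠ 0 := by exact_mod_cast (by omega : n ≠ 0)
  have hn1 : (n : ℂ) - 1 ≠ 0 := by
    rw [sub_ne_zero]; exact_mod_cast (by omega : n ≠ 1)
  let w : Fin n → Fin n → ℂ := fun a => (n : ℂ) • Pi.single a 1 - 1
  have hw : ∀ a, ∑ i, w a i = 0 := by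
    intro a
    simp [w, Finset.sum_sub_distrib, Pi.single_apply]
  apply isIrreducible_toRepresentation
  · intro hbot
    have : w ⟨0, by omega⟩ ∈ (sumZero n).toSubmodule := mem_sumZero.mpr (hw _)
    rw [hbot, Submodule.mem_bot] at this
    have := congrFun this ⟨0, by omega⟩
    simp [w] at this
    exact hn1 this
  · intro T hT hT0
    obtain ⟨v, hvT, hv0⟩ := Submodule.exists_mem_ne_zero_of_ne_bot hT0
    have hvs := mem_sumZero.mp (hT hvT)
    obtain ⟨a, ha⟩ := Function.ne_iff.mp hv0
    have hwa : w a ∈ T.toSubmodule := by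
      let H := MulAction.stabilizer (alternatingGroup (Fin n)) a
      let u : Fin n → ℂ := ∑ h : H, permRep _ (Fin n) (h : alternatingGroup (Fin n)) v
      have huT : u ∈ T.toSubmodule := Submodule.sum_mem _ fun h _ => T.apply_mem_toSubmodule _ hvT
      have hua : u a = Fintype.card H * v a := by
        simp only [u, Finset.sum_apply, permRep_apply]
        rw [Finset.sum_congr rfl (g := fun _ => v a), Finset.sum_const, Finset.card_univ,
          nsmul_eq_mul]
        intro h _
        rw [show (h : alternatingGroup (Fin n))⁻¹ • a = a from (h⁻¹).2]
      have hus := mem_sumZero.mp (hT huT)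
      have huinv : ∀ i j, i ≠ a → j ≠ a → u i = u j := by
        intro i j hi hj
        obtain ⟨g, hga, hgi⟩ := exists_alternating_apply hn hi hj
        have hg : g ∈ H := hga
        simp only [u, Finset.sum_apply, permRep_apply]
        rw [← Equiv.sum_comp (Equiv.mulLeft (⟨g, hg⟩ : H))
          (fun h : H => v ((h : alternatingGroup (Fin n))⁻¹ • j))]
        refine Finset.sum_congr rfl fun h _ => ?_
        congr 1
        simp [mul_smul, ← hgi]
      have hform : ∀ i, i ≠ a → ((n : ℂ) - 1) * u i = - u a := by
        intro i hi
        rw [← Finset.add_sum_erase _ _ (Finset.mem_univ a)] at hus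
        rw [Finset.sum_congr rfl (g := fun _ => u i) (fun j hj =>
          huinv j i (Finset.ne_of_mem_erase hj) hi), Finset.sum_const,
          Finset.card_erase_of_mem (Finset.mem_univ a), Finset.card_univ, Fintype.card_fin,
          nsmul_eq_mul, Nat.cast_sub (by omega), Nat.cast_one] at hus
        linear_combination hus
      have hc : u a ≠ 0 := by
        rw [hua]
        exact mul_ne_zero (by exact_mod_cast Fintype.card_ne_zero) ha
      have : w a = (((n : ℂ) - 1) / u a) • u := by
        ext i
        by_cases hi : i = a
        · subst hi
          simp [w, hc]
        · simp only [w, Pi.sub_apply, Pi.smul_apply, Pi.single_apply, if_neg hi, smul_eq_mul,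
            Pi.one_apply]
          rw [div_mul_eq_mul_div, hform i hi, neg_div, div_self hc]
          ring
      rw [this]
      exact Submodule.smul_mem _ _ huT
    have hwb : ∀ b, w b ∈ T.toSubmodule := by
      intro b
      obtain ⟨c, hc⟩ : ∃ c, c ∉ ({a, b} : Finset (Fin n)) := by
        by_contra! hcon
        have h1 := Finset.card_le_two (a := a) (b := b)
        rw [Finset.eq_univ_of_forall hcon, Finset.card_univ, Fintype.card_fin] at h1
        omega
      simp only [Finset.mem_insert, Finset.mem_singleton, not_or] at hc
      obtain ⟨g, -, hg⟩ := exists_alternating_apply hn (Ne.symm hc.1) (Ne.symm hc.2)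
      have := T.apply_mem_toSubmodule g hwa
      convert this using 1
      ext i
      simp only [w, permRep_apply, Pi.sub_apply, Pi.smul_apply, Pi.single_apply,
        inv_smul_eq_iff, hg]
      rfl
    intro x hx
    have hxs := mem_sumZero.mp hx
    have : x = (n : ℂ)⁻¹ • ∑ b, x b • w b := by
      ext i
      simp only [w, Pi.smul_apply, Finset.sum_apply, Pi.sub_apply, Pi.single_apply, smul_eq_mul,
        Pi.one_apply, mul_sub, Finset.sum_sub_distrib, mul_one, hxs]
      simp
      field_simp
    rw [this]
    exact Submodule.smul_mem _ _ (Submodule.sum_mem _ fun b _ => Submodule.smul_mem _ _ (hwb b))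

lemma character_sumZero (hn : n ≠ 0) : (sumZero n).toRepresentation.character = altChar n := by
  have hn0 : (n : ℂ) ≠ 0 := by exact_mod_cast hn
  ext σ
  let J : (Fin n → ℂ) →ₗ[ℂ] (Fin n → ℂ) :=
    LinearMap.pi fun _ => (n : ℂ)⁻¹ • ∑ i : Fin n, (LinearMap.proj i : (Fin n → ℂ) →ₗ[ℂ] ℂ)
  have hJ : ∀ v i, J v i = (n : ℂ)⁻¹ * ∑ j, v j := by
    intro v i
    simp [J]
  -- `J` projects onto the constant functions, so `P` agrees with `σ` on `sumZero n`
  -- and maps into it.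
  let P := permRep (alternatingGroup (Fin n)) (Fin n) σ ∘ₗ (LinearMap.id - J)
  have hP : ∀ v, P v ∈ (sumZero n).toSubmodule := by
    intro v
    refine (sumZero n).apply_mem_toSubmodule σ (v := v - J v) ?_
    rw [mem_sumZero]
    simp [hJ, Finset.sum_sub_distrib, hn0]
  have hres : (sumZero n).toRepresentation σ = P.restrict fun v _ => hP v := by
    ext v i
    have hv := mem_sumZero.mp v.2
    change v.1 _ = v.1 _ - J v.1 _
    rw [hJ, hv, mul_zero, sub_zero]
  rw [Representation.character, hres, LinearMap.trace_restrict_eq_of_forall_mem _ _ hP, trace_pi,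
    altChar]
  have : ∀ i, P (Pi.single i 1) i = (if (σ : Perm (Fin n)) i = i then 1 else 0) - (n : ℂ)⁻¹ := by
    intro i
    change (Pi.single i (1 : ℂ) : Fin n → ℂ) (σ⁻¹ • i) - J (Pi.single i 1) _ = _
    rw [hJ, Finset.sum_pi_single']
    simp only [Pi.single_apply, Finset.mem_univ, if_true, mul_one, inv_smul_eq_iff]
    simp only [eq_comm (a := i)]
    rfl
  simp_rw [this]
  rw [Finset.sum_sub_distrib, Finset.sum_boole, Finset.sum_const, Finset.card_univ,
    Fintype.card_fin, nsmul_eq_mul, mul_inv_cancel₀ hn0, Nat.card_eq_fintype_card,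
    Fintype.card_subtype]

theorem isIrreducibleCharacter_altChar (hn : 4 ≤ n) : IsIrreducibleCharacter (altChar n) :=
  ⟨(sumZero n).toSubmodule, inferInstance, inferInstance, inferInstance,
    (sumZero n).toRepresentation, isIrreducible_sumZero hn, character_sumZero (by omega)⟩

lemma altChar_one : altChar n 1 = n - 1 := by simp [altChar_eq]

lemma altChar_mulAut (hn : 5 ≤ n) (hn6 : n ≠ 6) (a : MulAut (alternatingGroup (Fin n)))
    (σ : alternatingGroup (Fin n)) : altChar n (a σ) = altChar n σ := by
  rw [altChar_eq, altChar_eq, card_support_mulAut hn hn6]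

/-- Frobenius' functional equation for the character `altChar n`. -/
lemma altChar_functional_equation (hn : 4 ≤ n) (a b : alternatingGroup (Fin n)) :
    ((n : ℂ) - 1) * ∑ h, altChar n (h * a * h⁻¹ * b) =
      Fintype.card (alternatingGroup (Fin n)) * (altChar n a * altChar n b) := by
  have := char_one_mul_sum_char_conj_mul _ (isIrreducible_sumZero hn) a b
  rwa [character_sumZero (by omega), altChar_one] at this

end NaturalCharacter

/-! ### Irreducible characters lying over an invariant character -/

section CentralElement

/-- An endomorphism of a finite-dimensional complex space with nonzero trace has a nonzero
eigenvalue. -/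
lemma exists_hasEigenvalue_ne_zero {V : Type*} [AddCommGroup V] [Module ℂ V]
    [FiniteDimensional ℂ V] (e : Module.End ℂ V) (he : LinearMap.trace ℂ V e ≠ 0) :
    ∃ c : ℂ, c ≠ 0 ∧ e.HasEigenvalue c := by
  by_contra! hcon
  apply he
  rw [Module.End.trace_eq_sum_roots_charpoly_of_splits (IsAlgClosed.splits _)]
  apply Multiset.sum_eq_zero
  intro c hc
  by_contra h0
  exact hcon c h0 ((Module.End.hasEigenvalue_iff_isRoot_charpoly e c).mpr
    (Polynomial.isRoot_of_mem_roots hc))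

/-- Let `θ` be a function on `N` invariant under conjugation by an overgroup `G`, whose convolution
with every class function is a multiple of `θ`. Then `θ` is up to a factor the restriction of an
irreducible character of `G`. -/
theorem exists_irreducible_restrict_eq {N G : Type} [Group N] [Fintype N] [Group G] [Finite G]
    (f : N →* G) (hf : Function.Injective f) (θ : N → ℂ) (hθ : θ 1 ≠ 0)
    (hinv : ∀ g : G, ∃ a : MulAut N, (∀ x, g * f x * g⁻¹ = f (a x)) ∧ ∀ x, θ (a x) = θ x)
    (hconv : ∀ F : N → ℂ, (∀ h z, F (h * z * h⁻¹) = F z) →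
      ∃ c, ∀ x, ∑ z, F z * θ (z⁻¹ * x) = c * θ x) :
    ∃ χ : G → ℂ, IsIrreducibleCharacter χ ∧ ∃ c : ℂ, c ≠ 0 ∧ ∀ x, χ (f x) = c * θ x := by
  classical
  have : Fintype G := Fintype.ofFinite G
  let ρ := permRep G G
  let e : Module.End ℂ (G → ℂ) := ∑ y : N, θ y⁻¹ • ρ (f y)
  -- In the regular representation only the term `y = 1` contributes to the trace.
  have htr : LinearMap.trace ℂ _ e ≠ 0 := by
    have h1 : ∀ y : N, LinearMap.trace ℂ _ (ρ (f y)) =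
        if y = 1 then (Fintype.card G : ℂ) else 0 := by
      intro y
      rw [trace_pi]
      simp only [ρ, permRep_apply, Pi.single_apply, smul_eq_mul, mul_eq_right, inv_eq_one,
        map_eq_one_iff f hf]
      simp
    simp only [e, map_sum, map_smul, h1, smul_eq_mul, mul_ite, mul_zero]
    simp [hθ]
  obtain ⟨l, hl0, hl⟩ := exists_hasEigenvalue_ne_zero e htr
  have hcomm : ∀ g, e * ρ g = ρ g * e := by
    intro g
    obtain ⟨a, ha, hθa⟩ := hinv g
    simp only [e, Finset.sum_mul, Finset.mul_sum, smul_mul_assoc, mul_smul_comm, ← map_mul]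
    rw [← Equiv.sum_comp a.toEquiv]
    refine Finset.sum_congr rfl fun y _ => ?_
    change θ (a y)⁻¹ • ρ (f (a y) * g) = _
    rw [← map_inv, hθa, ← ha, inv_mul_cancel_right]
  let E : Subrepresentation ρ := ⟨e.eigenspace l, by
    intro g v hv
    rw [Module.End.mem_eigenspace_iff] at hv ⊢
    change (e * ρ g) v = _
    rw [hcomm, Module.End.mul_apply, hv, map_smul]⟩
  obtain ⟨S, hSE, hS0, hS⟩ := exists_irreducible_le E hl
  refine ⟨S.toRepresentation.character, ⟨S.toSubmodule, inferInstance, inferInstance,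
    inferInstance, S.toRepresentation, hS, rfl⟩, ?_⟩
  set χ := S.toRepresentation.character
  obtain ⟨c, hc⟩ := hconv (fun z => χ (f z)) (by
    intro h z
    simp only [map_mul, map_inv]
    exact Representation.char_conj _ _ _)
  have hSe : ∑ y : N, θ y⁻¹ • S.toRepresentation (f y) = l • 1 := by
    ext v
    have hv := Module.End.mem_eigenspace_iff.mp (hSE v.2)
    simp only [LinearMap.sum_apply, LinearMap.smul_apply, Submodule.coe_sum, Submodule.coe_smul]
    rw [show ((1 : Module.End ℂ S.toSubmodule) v : G → ℂ) = v from rfl, ← hv]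
    simp only [e, LinearMap.sum_apply, LinearMap.smul_apply]
    rfl
  have key : ∀ x, l * χ (f x) = c * θ x := by
    intro x
    rw [← hc x]
    calc l * χ (f x) = LinearMap.trace ℂ _ (S.toRepresentation (f x) * l • 1) := by
          rw [mul_smul_comm, mul_one, map_smul, smul_eq_mul]; rfl
      _ = ∑ y, θ y⁻¹ * χ (f (x * y)) := by
          rw [← hSe, Finset.mul_sum, map_sum]
          refine Finset.sum_congr rfl fun y _ => ?_
          rw [mul_smul_comm, map_smul, smul_eq_mul, ← map_mul, ← map_mul]; rfl
      _ = ∑ z, χ (f z) * θ (z⁻¹ * x) := by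
          rw [← Equiv.sum_comp (Equiv.mulLeft x) fun z => χ (f z) * θ (z⁻¹ * x)]
          refine Finset.sum_congr rfl fun y _ => ?_
          rw [Equiv.coe_mulLeft, mul_inv_rev, inv_mul_cancel_right, mul_comm]
  have hnt : Nontrivial S.toSubmodule := Submodule.nontrivial_iff_ne_bot.mpr hS0
  have hχ1 : χ 1 ≠ 0 := by
    simp only [χ, Representation.char_one]
    exact_mod_cast Module.finrank_pos.ne'
  refine ⟨c / l, ?_, fun x => ?_⟩
  · rw [div_ne_zero_iff]
    refine ⟨?_, hl0⟩
    rintro rfl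
    have := key 1
    rw [map_one, zero_mul] at this
    exact mul_ne_zero hl0 hχ1 this
  · rw [div_mul_eq_mul_div, ← key, mul_div_cancel_left₀ _ hl0]

end CentralElement

/-! ### The product character on a power of the alternating group -/

section Product

variable {n m : ℕ}

/-- The character `χ_n × ⋯ × χ_n` of the power `A_n ^ m`. -/
noncomputable def altCharProd (n m : ℕ) (x : Fin m → alternatingGroup (Fin n)) : ℂ :=
  ∏ i, altChar n (x i)

/-- Frobenius' functional equation, multiplied over the factors. -/
lemma altCharProd_functional_equation (hn : 4 ≤ n) (a b : Fin m → alternatingGroup (Fin n)) :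
    ((n : ℂ) - 1) ^ m * ∑ h, altCharProd n m (h * a * h⁻¹ * b) =
      (Fintype.card (alternatingGroup (Fin n)) : ℂ) ^ m *
        (altCharProd n m a * altCharProd n m b) := by
  have h1 : ∑ h, altCharProd n m (h * a * h⁻¹ * b) =
      ∏ i, ∑ h, altChar n (h * a i * h⁻¹ * b i) := by
    rw [Finset.prod_univ_sum, Fintype.piFinset_univ]
    rfl
  have h2 : ∀ c : ℂ, c ^ m = ∏ _i : Fin m, c := by simp
  rw [h1, h2, h2, ← Finset.prod_mul_distrib]
  simp only [altChar_functional_equation hn, Finset.prod_mul_distrib, altCharProd]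

lemma altCharProd_one_ne_zero (hn : 2 ≤ n) : altCharProd n m 1 ≠ 0 := by
  rw [altCharProd, Finset.prod_ne_zero_iff]
  intro i _
  rw [Pi.one_apply, altChar_one, sub_ne_zero]
  exact_mod_cast (by omega : n ≠ 1)

/-- The convolution of a class function with an irreducible character is a multiple of the
latter. -/
lemma exists_sum_mul_altCharProd (hn : 4 ≤ n) (F : (Fin m → alternatingGroup (Fin n)) → ℂ)
    (hF : ∀ h z, F (h * z * h⁻¹) = F z) :
    ∃ c, ∀ x, ∑ z, F z * altCharProd n m (z⁻¹ * x) = c * altCharProd n m x := by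
  have hn1 : (n : ℂ) - 1 ≠ 0 := by
    rw [sub_ne_zero]; exact_mod_cast (by omega : n ≠ 1)
  have hN : (Fintype.card (Fin m → alternatingGroup (Fin n)) : ℂ) ≠ 0 := by
    exact_mod_cast Fintype.card_ne_zero
  have key : ∀ x, ((n : ℂ) - 1) ^ m * (Fintype.card (Fin m → alternatingGroup (Fin n)) *
      ∑ z, F z * altCharProd n m (z⁻¹ * x)) =
      (Fintype.card (alternatingGroup (Fin n)) : ℂ) ^ m *
        (∑ z, F z * altCharProd n m z⁻¹) * altCharProd n m x := by
    intro x
    have h1 : ∀ h : Fin m → alternatingGroup (Fin n), ∑ z, F z * altCharProd n m (z⁻¹ * x) =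
        ∑ z, F z * altCharProd n m (h * z⁻¹ * h⁻¹ * x) := by
      intro h
      rw [← Equiv.sum_comp (MulAut.conj h).toEquiv]
      refine Finset.sum_congr rfl fun z _ => ?_
      change F (h * z * h⁻¹) * altCharProd n m ((h * z * h⁻¹)⁻¹ * x) = _
      rw [hF, conj_inv]
    have h2 : (Fintype.card (Fin m → alternatingGroup (Fin n)) : ℂ) *
        ∑ z, F z * altCharProd n m (z⁻¹ * x) =
        ∑ z, F z * ∑ h : Fin m → alternatingGroup (Fin n), altCharProd n m (h * z⁻¹ * h⁻¹ * x) := by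
      rw [← nsmul_eq_mul, ← Finset.card_univ, ← Finset.sum_const]
      rw [Finset.sum_congr rfl fun h _ => h1 h, Finset.sum_comm]
      simp_rw [Finset.mul_sum]
    rw [h2, Finset.mul_sum, Finset.mul_sum, Finset.sum_mul]
    refine Finset.sum_congr rfl fun z _ => ?_
    linear_combination F z * altCharProd_functional_equation hn z⁻¹ x
  refine ⟨(((n : ℂ) - 1) ^ m * Fintype.card (Fin m → alternatingGroup (Fin n)))⁻¹ *
    ((Fintype.card (alternatingGroup (Fin n)) : ℂ) ^ m * ∑ z, F z * altCharProd n m z⁻¹),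
    fun x => ?_⟩
  rw [mul_assoc, ← key x, ← mul_assoc (((n : ℂ) - 1) ^ m),
    inv_mul_cancel_left₀ (mul_ne_zero (pow_ne_zero _ hn1) hN)]

end Product

/-! ### Automorphisms of powers of simple groups -/

section AutPower

variable {S : Type*} [Group S] [Finite S] [IsSimpleGroup S] {m : ℕ}

/-- A nontrivial endomorphism of a finite simple group is bijective. -/
lemma bijective_of_ne_one {b : S →* S} {s : S} (hs : b s ≠ 1) : Function.Bijective b := by
  rw [← Finite.injective_iff_bijective, ← MonoidHom.ker_eq_bot_iff]
  rcases b.normal_ker.eq_bot_or_eq_top with h | h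
  · exact h
  · exact absurd (MonoidHom.mem_ker.mp (h ▸ Subgroup.mem_top s)) hs

/-- An automorphism of a power of a finite nonabelian simple group permutes the factors. -/
theorem exists_perm_mulAut_pi (hZ : Subgroup.center S = ⊥) (a : MulAut (Fin m → S)) :
    ∃ (p : Perm (Fin m)) (b : Fin m → MulAut S), ∀ x i, a x (p i) = b i (x i) := by
  have hcen : ∀ s : S, (∀ u, u * s = s * u) → s = 1 := by
    intro s hs
    rw [← Subgroup.mem_bot, ← hZ, Subgroup.mem_center_iff]
    exact hs
  obtain ⟨s₀, hs₀⟩ := exists_ne (1 : S)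
  let c : Fin m → Fin m → S →* S := fun i j =>
    (Pi.evalMonoidHom _ j).comp (a.toMonoidHom.comp (MonoidHom.mulSingle (fun _ => S) i))
  -- Each `c i j` is trivial or bijective; `p i` is the only `j` for which it is bijective.
  have hc : ∀ i j s, c i j s = a (Pi.mulSingle i s) j := fun i j s => rfl
  have hex : ∀ i, ∃ j, c i j s₀ ≠ 1 := by
    intro i
    by_contra! h
    have h1 : a (Pi.mulSingle i s₀) = 1 := funext fun j => h j
    rw [map_eq_one_iff a a.injective, Pi.mulSingle_eq_one_iff] at h1
    exact hs₀ h1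
  choose p hp using hex
  have hbij : ∀ i, Function.Bijective (c i (p i)) := fun i => bijective_of_ne_one (hp i)
  have hoff : ∀ i k, k ≠ p i → ∀ s, c i k s = 1 := by
    intro i k hk
    by_contra! h
    obtain ⟨s₁, hs₁⟩ := h
    have hinj := (bijective_of_ne_one hs₁).1
    apply hp i
    apply hcen
    intro u
    let y := a⁻¹ (Pi.mulSingle (p i) u)
    have hy : a y = Pi.mulSingle (p i) u := a.apply_symm_apply _
    have hs' : a (Pi.mulSingle i (y i * s₀ * (y i)⁻¹ * s₀⁻¹)) =
        Pi.mulSingle (p i) u * a (Pi.mulSingle i s₀) * (Pi.mulSingle (p i) u)⁻¹ *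
          (a (Pi.mulSingle i s₀))⁻¹ := by
      have h1 : a (y * Pi.mulSingle i s₀ * y⁻¹ * (Pi.mulSingle i s₀)⁻¹) =
          Pi.mulSingle (p i) u * a (Pi.mulSingle i s₀) * (Pi.mulSingle (p i) u)⁻¹ *
            (a (Pi.mulSingle i s₀))⁻¹ := by
        rw [map_mul, map_mul, map_mul, map_inv, map_inv, hy]
      rw [← h1]
      congr 1
      ext l
      by_cases hl : l = i
      · subst hl; simp
      · simp [hl]
    have h1 : c i k (y i * s₀ * (y i)⁻¹ * s₀⁻¹) = c i k 1 := by
      rw [map_one, hc, hs']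
      simp [hk]
    have h2 := hinj h1
    have h3 := congrFun hs' (p i)
    rw [h2] at h3
    simp only [Pi.mulSingle_one, map_one, Pi.one_apply, Pi.mul_apply, Pi.inv_apply,
      Pi.mulSingle_eq_same] at h3
    rw [hc]
    exact (mul_inv_eq_iff_eq_mul.mp (mul_inv_eq_one.mp h3.symm))
  have hpinj : Function.Injective p := by
    intro i i' hii
    by_contra hne
    apply hp i
    apply hcen
    intro u
    obtain ⟨s, rfl⟩ := (hbij i').2 u
    rw [hc, hc, ← hii, ← Pi.mul_apply, ← Pi.mul_apply, ← map_mul, ← map_mul,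
      (Pi.mulSingle_commute (f := fun _ => S) (Ne.symm hne) s s₀).eq]
  refine ⟨Equiv.ofBijective p (Finite.injective_iff_bijective.mp hpinj),
    fun i => MulEquiv.ofBijective (c i (p i)) (hbij i), fun x i => ?_⟩
  change a x (p i) = a (Pi.mulSingle i (x i)) (p i)
  -- The remaining part of `x` commutes with the `i`-th factor, so its image has
  -- a central component.
  obtain ⟨y, hy⟩ : ∃ y, x = Pi.mulSingle i (x i) * y := ⟨(Pi.mulSingle i (x i))⁻¹ * x, by simp⟩
  have hyi : y i = 1 := by
    have := congrFun hy i
    simpa using this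
  have h1 : a y (p i) = 1 := by
    apply hcen
    intro u
    obtain ⟨s, rfl⟩ := (hbij i).2 u
    rw [hc, ← Pi.mul_apply, ← Pi.mul_apply, ← map_mul, ← map_mul]
    have hcom : Pi.mulSingle i s * y = y * Pi.mulSingle i s := by
      ext l
      by_cases hl : l = i
      · subst hl; simp [hyi]
      · simp [hl]
    rw [hcom]
  conv_lhs => rw [hy]
  rw [map_mul, Pi.mul_apply, h1, mul_one]

end AutPower

/-! ### Restricting induced characters -/

section CharacterSums

/-- The sum of a character over the group counts invariants, and so is a natural number. -/
lemma exists_nat_sum_character {H V : Type*} [Group H] [Fintype H] [AddCommGroup V] [Module ℂ V]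
    [FiniteDimensional ℂ V] (ρ : Representation ℂ H V) :
    ∃ N : ℕ, ∑ h, ρ.character h = N := by
  have hH : (Nat.card H : ℂ) ≠ 0 := by exact_mod_cast Nat.card_pos.ne'
  have := invertibleOfNonzero hH
  refine ⟨Nat.card H * Module.finrank ℂ ρ.invariants, ?_⟩
  rw [Nat.cast_mul, ← Representation.card_inv_mul_sum_char_eq_finrank, mul_inv_cancel_left₀ hH]

open scoped Classical in
/-- The restriction of a character of `U` to the subgroup `g⁻¹(U)` has a natural number as its sum;
extending it by zero gives the terms of the induced character. -/
lemma exists_nat_sum_dite_character {S G V : Type*} [Group S] [Fintype S] [Group G]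
    [AddCommGroup V] [Module ℂ V] [FiniteDimensional ℂ V] (U : Subgroup G)
    (ρ : Representation ℂ U V) (g : S →* G) :
    ∃ N : ℕ, ∑ t, (if h : g t ∈ U then ρ.character ⟨g t, h⟩ else 0) = N := by
  let T : Subgroup S := U.comap g
  let ψ : T →* U := (g.comp T.subtype).codRestrict U fun t => t.2
  obtain ⟨N, hN⟩ := exists_nat_sum_character (ρ.comp ψ)
  refine ⟨N, ?_⟩
  rw [← hN, ← Finset.sum_filter_of_ne (p := (· ∈ T)),
    Finset.sum_subtype (Finset.univ.filter (· ∈ T)) (p := (· ∈ T)) (by simp)]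
  · exact Finset.sum_congr rfl fun t _ => dif_pos t.2
  · intro t _ ht
    by_contra hcon
    exact ht (dif_neg hcon)

open scoped Classical in
/-- If `φ` is the character of a nonzero representation of `U` that is trivial on the image of `S`,
then the restriction of the induced character to `S` contains the trivial character. -/
lemma sum_inducedCharacter_ne_zero {S G V : Type*} [Group S] [Fintype S] [Group G] [Finite G]
    [AddCommGroup V] [Module ℂ V] [FiniteDimensional ℂ V] [Nontrivial V] (U : Subgroup G)
    (ρ : Representation ℂ U V) (g : S →* G) (hgU : ∀ t, g t ∈ U)
    (hg : ∀ t, ρ ⟨g t, hgU t⟩ = 1) : ∑ t, inducedCharacter U ρ.character (g t) ≠ 0 := by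
  have : Fintype G := Fintype.ofFinite G
  have hex : ∀ y : G, ∃ N : ℕ, ∑ t, (if h : y⁻¹ * g t * y ∈ U then
      ρ.character ⟨y⁻¹ * g t * y, h⟩ else 0) = N := by
    intro y
    have h1 : ∀ t, ((MulAut.conj y⁻¹).toMonoidHom.comp g) t = y⁻¹ * g t * y := by
      intro t
      simp
    obtain ⟨N, hN⟩ := exists_nat_sum_dite_character U ρ ((MulAut.conj y⁻¹).toMonoidHom.comp g)
    simp only [h1] at hN
    exact ⟨N, hN⟩
  choose N hN using hex
  have hU : (Nat.card U : ℂ) ≠ 0 := by exact_mod_cast Nat.card_pos.ne'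
  have hN1 : N 1 ≠ 0 := by
    have h1 : ∀ t : S, ((1 : G)⁻¹ * g t * 1) = g t := by simp
    have h2 := hN 1
    simp only [h1, hgU, dif_pos] at h2
    have h3 : ∀ t, ρ.character ⟨g t, hgU t⟩ = Module.finrank ℂ V := by
      intro t
      rw [Representation.character, hg, LinearMap.trace_one]
    simp only [h3, Finset.sum_const, Finset.card_univ, nsmul_eq_mul] at h2
    intro h0
    rw [h0] at h2
    have : Fintype.card S * Module.finrank ℂ V = 0 := by exact_mod_cast h2
    rcases mul_eq_zero.mp this with h | h
    · exact Fintype.card_ne_zero h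
    · exact Module.finrank_pos.ne' h
  have heq : ∑ t, inducedCharacter U ρ.character (g t) =
      (Nat.card U : ℂ)⁻¹ * ((∑ y, N y : ℕ) : ℂ) := by
    simp only [inducedCharacter]
    rw [← Finset.mul_sum, Finset.sum_comm, Nat.cast_sum]
    congr 1
    rw [Subsingleton.elim (Fintype.ofFinite G) this]
    exact Finset.sum_congr rfl fun y _ => hN y
  rw [heq]
  refine mul_ne_zero (inv_ne_zero hU) ?_
  rw [Nat.cast_ne_zero]
  intro h
  exact hN1 (Finset.sum_eq_zero_iff.mp h 1 (Finset.mem_univ _))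

/-- A homomorphism from a nonabelian simple group to a solvable group is trivial. -/
lemma eq_one_of_isSolvable {S Q : Type*} [Group S] [IsSimpleGroup S] [Group Q]
    (hS : ¬ Group.IsSolvable S) (hQ : Group.IsSolvable Q) (g : S →* Q) (t : S) : g t = 1 := by
  rcases g.normal_ker.eq_bot_or_eq_top with h | h
  · exact absurd (Group.isSolvable_of_isSolvable_injective ((MonoidHom.ker_eq_bot_iff g).mp h)) hS
  · exact MonoidHom.mem_ker.mp (h ▸ Subgroup.mem_top t)

end CharacterSums

/-! ### Failure of quasi solvable induction -/

section NotQSI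

variable {n m : ℕ}

lemma altChar_ne_zero_iff (σ : alternatingGroup (Fin n)) :
    altChar n σ ≠ 0 ↔ (σ : Perm (Fin n)).support.card + 1 ≠ n := by
  rw [altChar_eq, sub_sub, sub_ne_zero, ne_comm, add_comm]
  exact_mod_cast Iff.rfl

lemma exists_threeCycle (hn : 5 ≤ n) :
    ∃ σ : alternatingGroup (Fin n), (σ : Perm (Fin n)).support.card = 3 := by
  obtain ⟨c, hc, hcl⟩ := exists_isCycle (n := n) 3 (by omega) (by omega)
  exact ⟨⟨c, (card_support_eq_three_iff.mp hcl).mem_alternatingGroup⟩, hcl⟩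

/-- The trivial character is not a constituent of `altChar n`: sum the functional equation over `a`,
for a three-cycle `b`, where `altChar n b ≠ altChar n 1`. -/
lemma sum_altChar (hn : 5 ≤ n) : ∑ t, altChar n t = 0 := by
  obtain ⟨b, hb⟩ := exists_threeCycle hn
  have h1 : ∀ h, ∑ a, altChar n (h * a * h⁻¹ * b) = ∑ a, altChar n a := by
    intro h
    exact Equiv.sum_comp ((MulAut.conj h).toEquiv.trans (Equiv.mulRight b)) (altChar n)
  have h2 := Finset.sum_congr (rfl : Finset.univ = Finset.univ) fun a _ =>
    altChar_functional_equation (n := n) (by omega) a b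
  rw [← Finset.mul_sum, Finset.sum_comm, Finset.sum_congr rfl fun h _ => h1 h, Finset.sum_const,
    Finset.card_univ, nsmul_eq_mul, ← Finset.mul_sum, ← Finset.sum_mul, altChar_eq, hb] at h2
  have h3 : (Fintype.card (alternatingGroup (Fin n)) : ℂ) ≠ 0 := by
    exact_mod_cast Fintype.card_ne_zero
  have h4 : (Fintype.card (alternatingGroup (Fin n)) : ℂ) * (3 * ∑ t, altChar n t) = 0 := by
    push_cast at h2
    linear_combination h2
  exact (mul_eq_zero.mp ((mul_eq_zero.mp h4).resolve_left h3)).resolve_left (by norm_num)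

lemma altCharProd_mulSingle (j : Fin m) (t : alternatingGroup (Fin n)) :
    altCharProd n m (Pi.mulSingle j t) = altChar n t * ((n : ℂ) - 1) ^ (m - 1) := by
  rw [altCharProd, ← Finset.mul_prod_erase _ _ (Finset.mem_univ j), Pi.mulSingle_eq_same,
    Finset.prod_congr rfl (g := fun _ => (n : ℂ) - 1), Finset.prod_const,
    Finset.card_erase_of_mem (Finset.mem_univ j), Finset.card_univ, Fintype.card_fin]
  intro i hi
  rw [Pi.mulSingle_eq_of_ne (Finset.ne_of_mem_erase hi), altChar_one]

lemma isSimpleGroup_alternating (hn : 5 ≤ n) : IsSimpleGroup (alternatingGroup (Fin n)) :=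
  alternatingGroup.isSimpleGroup (by simpa using hn)

lemma center_alternating (hn : 5 ≤ n) : Subgroup.center (alternatingGroup (Fin n)) = ⊥ :=
  alternatingGroup.center_eq_bot (by simpa using (by omega : 4 ≤ n))

lemma not_isSolvable_alternating (hn : 5 ≤ n) :
    ¬ Group.IsSolvable (alternatingGroup (Fin n)) := by
  have := isSimpleGroup_alternating hn
  intro h
  have h1 := IsSimpleGroup.comm_iff_isSolvable.mpr h
  have h2 : Subgroup.center (alternatingGroup (Fin n)) = ⊤ := by
    rw [eq_top_iff]
    intro x _
    exact Subgroup.mem_center_iff.mpr fun g => h1 g x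
  rw [center_alternating hn] at h2
  exact bot_ne_top h2

lemma altCharProd_mulAut (hn : 5 ≤ n) (hn6 : n ≠ 6)
    (a : MulAut (Fin m → alternatingGroup (Fin n))) (x : Fin m → alternatingGroup (Fin n)) :
    altCharProd n m (a x) = altCharProd n m x := by
  have := isSimpleGroup_alternating hn
  obtain ⟨p, b, hab⟩ := exists_perm_mulAut_pi (center_alternating hn) a
  rw [altCharProd, ← Equiv.prod_comp p]
  exact Finset.prod_congr rfl fun i _ => by rw [hab, altChar_mulAut hn hn6]

/-- A function whose restriction to a subgroup `A_n ^ m` is a nonzero multiple of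
`χ_n × ⋯ × χ_n` is not quasi solvably induced, if the overgroup normalizes `A_n ^ m`. -/
theorem not_isQSIFrom_of_restrict_eq (hn : 5 ≤ n) (hn6 : n ≠ 6) (hm : 1 ≤ m) {G : Type*} [Group G]
    [Finite G] (f : (Fin m → alternatingGroup (Fin n)) →* G)
    (hconj : ∀ g : G, ∃ a : MulAut (Fin m → alternatingGroup (Fin n)),
      ∀ x, g * f x * g⁻¹ = f (a x))
    (χ : G → ℂ) {c : ℂ} (hc : c ≠ 0) (hχ : ∀ x, χ (f x) = c * altCharProd n m x)
    (U : Subgroup G) (φ : U → ℂ) : ¬ IsQSIFrom χ U φ := by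
  classical
  have hsimple := isSimpleGroup_alternating hn
  have hn1 : (n : ℂ) - 1 ≠ 0 := by
    rw [sub_ne_zero]; exact_mod_cast (by omega : n ≠ 1)
  rintro ⟨⟨V, _, _, _, ρ, hρ, rfl, hsolv⟩, k, hk, hind⟩
  have hV : Nontrivial V := by
    by_contra h
    rw [not_nontrivial_iff_subsingleton] at h
    obtain ⟨A, B, hAB⟩ := hρ.exists_pair_ne
    exact hAB (SetLike.coe_injective (Set.ext fun v => by
      rw [Subsingleton.elim v 0]
      exact iff_of_true A.toSubmodule.zero_mem B.toSubmodule.zero_mem))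
  -- Where `χ` does not vanish, neither does the induced character.
  have hmem : ∀ x, altCharProd n m x ≠ 0 →
      ∃ a : MulAut (Fin m → alternatingGroup (Fin n)), f (a x) ∈ U := by
    intro x hx
    have h1 : inducedCharacter U ρ.character (f x) ≠ 0 := by
      rw [← hind, hχ]
      exact mul_ne_zero (by exact_mod_cast hk.ne') (mul_ne_zero hc hx)
    by_contra! hcon
    apply h1
    rw [inducedCharacter, mul_eq_zero]
    right
    apply Finset.sum_eq_zero
    intro y _
    rw [dif_neg]
    obtain ⟨a, ha⟩ := hconj y⁻¹
    rw [inv_inv] at ha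
    rw [ha]
    exact hcon a
  -- The elements `(s, …, s)` show that `U ∩ A_n ^ m` projects onto every factor.
  have hproj : ∀ (j : Fin m) (t : alternatingGroup (Fin n)), ∃ x, f x ∈ U ∧ x j = t := by
    intro j t
    let W : Subgroup (Perm (Fin n)) :=
      ((U.comap f).map (Pi.evalMonoidHom _ j)).map (alternatingGroup (Fin n)).subtype
    have hW : IsAbundant W := by
      intro s hs hcard
      obtain ⟨a, ha⟩ := hmem (fun _ => ⟨s, hs⟩) (Finset.prod_ne_zero_iff.mpr fun i _ =>
        (altChar_ne_zero_iff _).mpr hcard)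
      obtain ⟨p, b, hab⟩ := exists_perm_mulAut_pi (center_alternating hn) a
      refine ⟨_, ⟨_, ⟨_, ha, rfl⟩, rfl⟩, fun l => ?_⟩
      obtain ⟨i, rfl⟩ := p.surjective j
      change (((a (fun _ => ⟨s, hs⟩) (p i) : alternatingGroup (Fin n)) : Perm (Fin n)) ^
        l).support.card = _
      rw [hab, ← SubmonoidClass.coe_pow, ← map_pow, card_support_mulAut hn hn6]
      rfl
    obtain ⟨_, ⟨x, hx, rfl⟩, hxt⟩ := hW.alternatingGroup_le hn hn6 t.2
    exact ⟨x, hx, Subtype.ext hxt⟩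
  -- A three-cycle in one factor shows that `U` meets some factor nontrivially, so contains it.
  obtain ⟨j, hj⟩ : ∃ j : Fin m, ∀ t, f (Pi.mulSingle j t) ∈ U := by
    obtain ⟨s, hs⟩ := exists_threeCycle hn
    obtain ⟨a, ha⟩ := hmem (Pi.mulSingle ⟨0, hm⟩ s) (by
      rw [altCharProd_mulSingle]
      exact mul_ne_zero ((altChar_ne_zero_iff _).mpr (by omega)) (pow_ne_zero _ hn1))
    obtain ⟨p, b, hab⟩ := exists_perm_mulAut_pi (center_alternating hn) a
    have haj : a (Pi.mulSingle ⟨0, hm⟩ s) = Pi.mulSingle (p ⟨0, hm⟩) (b ⟨0, hm⟩ s) := by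
      ext1 l
      obtain ⟨i, rfl⟩ := p.surjective l
      rw [hab]
      by_cases hi : i = ⟨0, hm⟩
      · subst hi; simp
      · simp [hi]
    set j := p ⟨0, hm⟩
    refine ⟨j, ?_⟩
    let L : Subgroup (alternatingGroup (Fin n)) :=
      (U.comap f).comap (MonoidHom.mulSingle (fun _ => alternatingGroup (Fin n)) j)
    have hLmem : ∀ t, t ∈ L ↔ f (Pi.mulSingle j t) ∈ U := fun t => Iff.rfl
    have hLnorm : L.Normal := by
      refine ⟨fun t ht u => ?_⟩
      obtain ⟨x, hxU, rfl⟩ := hproj j u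
      rw [hLmem] at ht ⊢
      have : Pi.mulSingle j (x j * t * (x j)⁻¹) = x * Pi.mulSingle j t * x⁻¹ := by
        ext1 l
        by_cases hl : l = j
        · subst hl; simp
        · simp [hl]
      rw [this, map_mul, map_mul, map_inv]
      exact U.mul_mem (U.mul_mem hxU ht) (U.inv_mem hxU)
    have hLtop : L = ⊤ := by
      refine hLnorm.eq_bot_or_eq_top.resolve_left fun hbot => ?_
      have h1 : b ⟨0, hm⟩ s ∈ L := by
        rw [hLmem, ← haj]; exact ha
      rw [hbot, Subgroup.mem_bot, map_eq_one_iff _ (b ⟨0, hm⟩).injective] at h1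
      rw [h1] at hs
      simp at hs
    intro t
    exact (hLmem t).mp (hLtop ▸ Subgroup.mem_top t)
  let g : alternatingGroup (Fin n) →* G :=
    f.comp (MonoidHom.mulSingle (fun _ => alternatingGroup (Fin n)) j)
  have hgρ : ∀ t, ρ ⟨g t, hj t⟩ = 1 := by
    intro t
    have := eq_one_of_isSolvable (not_isSolvable_alternating hn) hsolv
      ((QuotientGroup.mk' ρ.ker).comp (g.codRestrict U hj)) t
    exact MonoidHom.mem_ker.mp ((QuotientGroup.eq_one_iff _).mp this)
  apply sum_inducedCharacter_ne_zero U ρ g hj hgρ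
  have hgχ : ∀ t, inducedCharacter U ρ.character (g t) =
      k * c * ((n : ℂ) - 1) ^ (m - 1) * altChar n t := by
    intro t
    rw [← hind, show g t = f (Pi.mulSingle j t) from rfl, hχ, altCharProd_mulSingle]
    ring
  simp_rw [hgχ]
  rw [← Finset.mul_sum, sum_altChar hn, mul_zero]

/-- No group between `A_n ^ m` and its automorphism group is QSI. -/
theorem not_isQSIGroup_of_range_conj_le (hn : 5 ≤ n) (hn6 : n ≠ 6) (hm : 1 ≤ m)
    (G : Subgroup (MulAut (Fin m → alternatingGroup (Fin n))))
    (hG : (MulAut.conj : (Fin m → alternatingGroup (Fin n)) →*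
      MulAut (Fin m → alternatingGroup (Fin n))).range ≤ G) : ¬ IsQSIGroup G := by
  intro hQSI
  let f : (Fin m → alternatingGroup (Fin n)) →* G :=
    MulAut.conj.codRestrict G fun x => hG ⟨x, rfl⟩
  have hconj : ∀ (g : G) x, g * f x * g⁻¹ = f ((g : MulAut _) x) := by
    intro g x
    apply Subtype.ext
    ext1 y
    change (g : MulAut _) (x * (g : MulAut _)⁻¹ y * x⁻¹) =
      (g : MulAut _) x * y * ((g : MulAut _) x)⁻¹
    rw [map_mul, map_mul, map_inv, MulAut.apply_inv_self]
  have hf : Function.Injective f := by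
    rw [← MonoidHom.ker_eq_bot_iff, eq_bot_iff]
    intro x hx
    have h1 : MulAut.conj x = 1 := congrArg Subtype.val (MonoidHom.mem_ker.mp hx)
    rw [Subgroup.mem_bot]
    ext1 i
    rw [Pi.one_apply, ← Subgroup.mem_bot, ← center_alternating hn, Subgroup.mem_center_iff]
    intro u
    have h2 : x * (fun _ => u) * x⁻¹ = fun _ => u := DFunLike.congr_fun h1 (fun _ => u)
    exact (mul_inv_eq_iff_eq_mul.mp (congrFun h2 i)).symm
  obtain ⟨χ, hχirr, c, hc, hχ⟩ := exists_irreducible_restrict_eq f hf (altCharProd n m)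
    (altCharProd_one_ne_zero (by omega))
    (fun g => ⟨g, hconj g, altCharProd_mulAut hn hn6 _⟩)
    (exists_sum_mul_altCharProd (by omega))
  obtain ⟨-, U, φ, hUφ⟩ := hQSI χ hχirr
  exact not_isQSIFrom_of_restrict_eq hn hn6 hm f (fun g => ⟨g, hconj g⟩) χ hc hχ U φ hUφ

theorem not_isQSICharacter_altChar (hn : 5 ≤ n) (hn6 : n ≠ 6) :
    ¬ IsQSICharacter (altChar n) := by
  rintro ⟨-, U, φ, hUφ⟩
  -- The simple group itself is the case `m = 1`.
  refine not_isQSIFrom_of_restrict_eq hn hn6 le_rfl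
    (Pi.evalMonoidHom (fun _ : Fin 1 => alternatingGroup (Fin n)) 0) (fun g => ?_) (altChar n)
    one_ne_zero (fun x => ?_) U φ hUφ
  · exact ⟨MulAut.conj fun _ => g, fun x => rfl⟩
  · simp [altCharProd]

end NotQSI

end QSI

theorem lemma3p1 (n : ℕ) (hn : 5 ≤ n) (hn6 : n ≠ 6) :
    (∀ (m : ℕ) (_hm : 1 ≤ m) (G : Subgroup (MulAut (Fin m → alternatingGroup (Fin n))))
      (_hG : (MulAut.conj : (Fin m → alternatingGroup (Fin n)) →*
        MulAut (Fin m → alternatingGroup (Fin n))).range ≤ G),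
      ¬ QSI.IsQSIGroup G) ∧
    (QSI.IsIrreducibleCharacter (QSI.altChar n) ∧
      (∀ (α : MulAut (alternatingGroup (Fin n))) (σ : alternatingGroup (Fin n)),
        QSI.altChar n (α σ) = QSI.altChar n σ) ∧
      ¬ QSI.IsQSICharacter (QSI.altChar n)) :=
  ⟨fun _ hm G hG => QSI.not_isQSIGroup_of_range_conj_le hn hn6 hm G hG,
    QSI.isIrreducibleCharacter_altChar (by omega), QSI.altChar_mulAut hn hn6,
    QSI.not_isQSICharacter_altChar hn hn6⟩
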